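/- Let $n\ge 1$ and let $U_n\subset\mathbb{R}^n$ be open. For a differentiable map $g$, a point $\mathbf{x}$ is regular if $dg_{\mathbf{x}}$ is injective, and $\mathrm{Reg}(g)$ is the set of regular points. A Gauss mapping of a real-analytic map $f$ on an open set $V$ is a real-analytic $\nu:V\to S^n\subset\mathbb{R}^{n+1}$ with $df_{\mathbf{x}}(\mathbf{v})\cdot\nu(\mathbf{x})=0$ for all $\mathbf{x}\in V$, $\mathbf{v}\in\mathbb{R}^n$. A real-analytic map $f:U_n\to\mathbb{R}^{n+1}$ is a pseudo regular frontal if $\mathrm{Reg}(f)$ is dense in $U_n$ and, for a Gauss mapping $\nu$ of $f|_{\mathrm{Reg}(f)}$, $\mathrm{Reg}(\nu)$ is dense in $\mathrm{Reg}(f)$. Its Legendre data is the family $\{(\nu(\mathbf{x}),a(\mathbf{x}))\}_{\mathbf{x}\in \mathrm{Reg}(\nu)}$, where $\nu:\mathrm{Reg}(f)\to S^n$ is a Gauss mapping of $f|_{\mathrm{Reg}(f)}$ and $a=f\cdot\nu$. Let $$\nu^n(\theta)=\Big(\prod_{i=1}^n\cos\theta_i,\ \sin\theta_n\prod_{i=1}^{n-1}\cos\theta_i,\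 \dots,\ \sin\theta_2\cos\theta_1,\ \sin\theta_1\Big),\qquad \tilde\mu_j=\frac{\partial\nu^n}{\partial\theta_j},\qquad \theta\in\left]-\pi,\pi\right[^n .$$ (1) Let $f$ be a pseudo regular frontal and let $\{(\nu(\mathbf{x}),a(\mathbf{x}))\}_{\mathbf{x}\in \mathrm{Reg}(\nu)}$ be Legendre data of $f$. Then $f$ is recovered from these data as follows. (a) Every $\mathbf{x}\in U_n$ is the limit of a sequence in $\mathrm{Reg}(\nu)$. (b) For every $\mathbf{y}\in\mathrm{Reg}(\nu)$ there are an orthogonal transformation $R$ of $\mathbb{R}^{n+1}$ and a map $\theta$ into $\mathbb{R}^n$, real-analytic at $\mathbf{y}$, with $\theta(\mathbf{y})\in\left]-\pi,\pi\right[^n$ and $\nu=R\circ\nu^n\circ\theta$ near $\mathbf{y}$. If $R$ is any orthogonal transformation (for example the identity) and $t\in\left]-\pi,\pi\right[^n$ satisfies $\nu(\mathbf{y})=R(\nu^n(t))$ and $\tilde\mu_j(t)\neq 0$ for all $j$, then there is such a $\theta$ for this $R$ with $\theta(\mathbf{y})=t$. (c) For every such $(R,\theta)$ at $\mathbf{y}\in\mathrm{Reg}(\nu)$,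 all $\tilde\mu_j(\theta(\mathbf{y}))$ are nonzero and the linear system $da_{\mathbf{y}}=b_1\,(d\theta_1)_{\mathbf{y}}+\dots+b_n\,(d\theta_n)_{\mathbf{y}}$ has a unique solution $b=(b_1,\dots,b_n)\in\mathbb{R}^n$. (d) For every $\mathbf{x}\in U_n$, every sequence $\mathbf{x}_i\in\mathrm{Reg}(\nu)$ with $\mathbf{x}_i\to\mathbf{x}$, all choices of $(R_i,\theta^{(i)})$ as in (b) at $\mathbf{x}_i$, and the solutions $b^{(i)}$ of the system in (c) at $\mathbf{x}_i$, $$f(\mathbf{x})=\lim_{i\to\infty}\Big(a(\mathbf{x}_i)\,\nu(\mathbf{x}_i)+\sum_{j=1}^n\frac{b^{(i)}_j}{|\tilde\mu_j(\theta^{(i)}(\mathbf{x}_i))|}\;R_i\Big(\frac{\tilde\mu_j(\theta^{(i)}(\mathbf{x}_i))}{|\tilde\mu_j(\theta^{(i)}(\mathbf{x}_i))|}\Big)\Big).$$ (2) The pseudo regular frontals form a dense subset of the space $A(U_n,\mathbb{R}^{n+1})$ of real-analytic maps $U_n\to\mathbb{R}^{n+1}$ with the Whitney $C^\infty$ topology,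 i.e. the topology generated by the sets $\{f : j^kf(U_n)\subset O\}$, with $k\in\mathbb{N}$ and $O$ open in the space of $k$-jets of maps $U_n\to\mathbb{R}^{n+1}$. -/

import Mathlib

open Filter Topology Set

noncomputable section

namespace LegendreRecovery

/-- `ℝᵐ` with its Euclidean norm and scalar product. -/
abbrev Euc (m : ℕ) : Type := EuclideanSpace ℝ (Fin m)

/-- Extension by zero of a map defined on an open set `U`. Since `U` is open, derivatives at
points of `U` do not depend on the values outside `U`. -/
def zeroExtend {n m : ℕ} (U : TopologicalSpace.Opens (Euc n)) (f : U → Euc m) :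
    Euc n → Euc m :=
  Function.extend Subtype.val f 0

/-- The set `A(U, ℝᵐ)` of real-analytic maps `U → ℝᵐ`. -/
def AnalyticMaps {n : ℕ} (U : TopologicalSpace.Opens (Euc n)) (m : ℕ) : Type :=
  {f : U → Euc m // AnalyticOnNhd ℝ (zeroExtend U f) (U : Set (Euc n))}

/-- The underlying map of an element of `A(U, ℝᵐ)`, extended by zero outside `U`. -/
def AnalyticMaps.toFun {n m : ℕ} {U : TopologicalSpace.Opens (Euc n)} (f : AnalyticMaps U m) :
    Euc n → Euc m :=
  zeroExtend U f.1

/-- The `k`-jet of `g` at `x`: the point `x` with the derivatives of `g` at `x` of orders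
`0, …, k`. -/
def jet {n m : ℕ} (k : ℕ) (g : Euc n → Euc m) (x : Euc n) :
    Euc n × ((j : Fin (k + 1)) → Euc n [×(j : ℕ)]→L[ℝ] Euc m) :=
  (x, fun j => iteratedFDeriv ℝ (j : ℕ) g x)

/-- The Whitney `C^∞` (strong) topology on `A(U, ℝᵐ)`: it is generated by the sets of all `f`
whose `k`-jet extension maps `U` into `O`, for all orders `k` and all open sets `O` of `k`-jets. -/
instance AnalyticMaps.whitneyTopology {n m : ℕ} {U : TopologicalSpace.Opens (Euc n)} :
    TopologicalSpace (AnalyticMaps U m) :=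
  TopologicalSpace.generateFrom
    {S | ∃ (k : ℕ) (O : Set (Euc n × ((j : Fin (k + 1)) → Euc n [×(j : ℕ)]→L[ℝ] Euc m))),
      IsOpen O ∧ S = {f | ∀ x ∈ U, jet k f.toFun x ∈ O}}

/-- The regular points in `V` of a map `g` defined on `V`: those at which `dg` is injective. For
maps from an open subset of `ℝⁿ` to the unit sphere of `ℝⁿ⁺¹` this is the same as being
bijective onto the tangent space of the sphere. -/
def regSet {n m : ℕ} (g : Euc n → Euc m) (V : Set (Euc n)) : Set (Euc n) :=
  {x | x ∈ V ∧ Function.Injective (fderiv ℝ g x)}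

/-- `ν` restricted to the open set `V` is a Gauss mapping of `f` restricted to `V`: a
real-analytic map to the unit sphere with `df_x(v) · ν(x) = 0`. -/
def IsGaussMap {n : ℕ} (f : Euc n → Euc (n + 1)) (V : Set (Euc n))
    (ν : Euc n → Euc (n + 1)) : Prop :=
  AnalyticOnNhd ℝ ν V ∧ ∀ x ∈ V, ‖ν x‖ = 1 ∧ ∀ v : Euc n, inner ℝ (fderiv ℝ f x v) (ν x) = 0

/-- Pseudo regular frontals: `Reg(f)` is dense in `U`, and for a Gauss mapping `ν` of
`f` restricted to `Reg(f)` the set `Reg(ν)` is dense in `Reg(f)`. -/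
def IsPseudoRegularFrontal {n : ℕ} {U : TopologicalSpace.Opens (Euc n)}
    (f : AnalyticMaps U (n + 1)) : Prop :=
  (U : Set (Euc n)) ⊆ closure (regSet f.toFun U) ∧
    ∃ ν : Euc n → Euc (n + 1), IsGaussMap f.toFun (regSet f.toFun U) ν ∧
      regSet f.toFun U ⊆ closure (regSet ν (regSet f.toFun U))

/-- The family `(ν(x), a(x))`, `x ∈ D`, is the Legendre data of `f`: for some Gauss mapping `ν₀`
of `f` restricted to `Reg(f)`, the index set `D` is `Reg(ν₀)`, and on `D` one has `ν = ν₀` and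
`a = f · ν₀`. Nothing is required of `ν` and `a` outside `D`. -/
def IsLegendreData {n : ℕ} {U : TopologicalSpace.Opens (Euc n)} (f : AnalyticMaps U (n + 1))
    (D : Set (Euc n)) (ν : Euc n → Euc (n + 1)) (a : Euc n → ℝ) : Prop :=
  ∃ ν₀ : Euc n → Euc (n + 1), IsGaussMap f.toFun (regSet f.toFun U) ν₀ ∧
    D = regSet ν₀ (regSet f.toFun U) ∧
    ∀ x ∈ D, ν x = ν₀ x ∧ a x = inner ℝ (f.toFun x) (ν₀ x)

/-- Spherical coordinates on the unit sphere of `ℝⁿ⁺¹`: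
`(∏_{i≤n} cos θᵢ, sin θₙ ∏_{i<n} cos θᵢ, …, sin θ₂ cos θ₁, sin θ₁)`. -/
def sph {n : ℕ} (θ : Euc n) : Euc (n + 1) :=
  WithLp.toLp 2 (Fin.cons (∏ i, Real.cos (θ i))
    (fun j : Fin n => Real.sin (θ j.rev) * ∏ i ∈ Finset.Iio j.rev, Real.cos (θ i)))

/-- The coordinate vector field `∂ sph / ∂ θⱼ`. -/
def coordField {n : ℕ} (θ : Euc n) (j : Fin n) : Euc (n + 1) :=
  fderiv ℝ sph θ (EuclideanSpace.single j 1)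

/-- The open cube `]-π, π[ⁿ`. -/
def angleCube (n : ℕ) : Set (Euc n) :=
  {θ | ∀ i, θ i ∈ Ioo (-Real.pi) Real.pi}

/-- `θ` expresses `ν` near `y` in the spherical coordinates rotated by the orthogonal
transformation `R` (the identity gives the standard ones): `ν = R ∘ sph ∘ θ` near `y`. -/
def IsSphericalLift {n : ℕ} (ν : Euc n → Euc (n + 1)) (y : Euc n)
    (R : Euc (n + 1) ≃ₗᵢ[ℝ] Euc (n + 1)) (θ : Euc n → Euc n) : Prop :=
  AnalyticAt ℝ θ y ∧ θ y ∈ angleCube n ∧ ∀ᶠ z in 𝓝 y, ν z = R (sph (θ z))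

/-- `b₁, …, bₙ` solve the linear system `da = b₁ dθ₁ + ⋯ + bₙ dθₙ` at `y`. -/
def SolvesSystem {n : ℕ} (a : Euc n → ℝ) (θ : Euc n → Euc n) (y : Euc n) (b : Fin n → ℝ) :
    Prop :=
  fderiv ℝ a y = ∑ j, b j • fderiv ℝ (fun z => θ z j) y

/-- The recovery formula `a ν + ∑ⱼ (bⱼ / |μ̃ⱼ|) μⱼ` at `y`, where `μ̃ⱼ` is the `j`-th coordinate
field at `θ(y)` and `μⱼ` is the (rotated) unit vector in the direction of `μ̃ⱼ`. -/
def recoveryFormula {n : ℕ} (ν : Euc n → Euc (n + 1)) (a : Euc n → ℝ) (y : Euc n)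
    (R : Euc (n + 1) ≃ₗᵢ[ℝ] Euc (n + 1)) (θ : Euc n → Euc n) (b : Fin n → ℝ) : Euc (n + 1) :=
  a y • ν y + ∑ j, (b j / ‖coordField (θ y) j‖) •
    R (‖coordField (θ y) j‖⁻¹ • coordField (θ y) j)

end LegendreRecovery

end

/-!
**Recovery.** Two Gauss mappings of an immersed hypersurface agree locally up to a sign, so `D` is
the dense set of the definition of a pseudo regular frontal. Spherical coordinates are orthogonal
(`inner_coordField_of_ne`, by induction on the dimension), so they are nondegenerate exactly where
no coordinate field vanishes, and there they have an analytic local inverse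
(`exists_local_angle`). If `ν = R ∘ sph ∘ θ` with `dν` injective, then `dθ` is bijective and
`d sph` is injective. Since `df ⊥ ν`, differentiating `a = f · ν` gives
`da = ∑ⱼ ⟨f, R (coordField θ j)⟩ dθⱼ`. Hence the solution of the linear system consists of the
components of `f` along the coordinate fields, and the recovery formula is the expansion of `f(y)` in
an orthonormal basis; the limit is the continuity of `f`.

**Density.** If the second fundamental form of `f` with respect to the generalized cross product of
its partial derivatives is nondegenerate on a dense set, then `f` is a pseudo regular frontal
(`isPseudoRegularFrontal_of_dense`). A given `f` is perturbed to `f + s⁻¹ h`. At a point where `h`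
is nondegenerate, so is `f + s⁻¹ h` for all but finitely many `s`, as the determinant is a polynomial
in `s` up to a power of `s`; a countable dense set of such points leaves only countably many
exceptional `s`. It remains to find `h` which is arbitrarily small in the Whitney topology and
nondegenerate on a dense set. Take `h(x) = φ(x) (1, x)` with `φ > 0`. This is an immersion, and as it
tends to zero at the boundary, `|h|` has a maximum on each component of `U`; there `h` is touched by
a sphere from outside and so is curved (`secondFormDet_ne_zero_of_isLocalMax`). By the identity
theorem it is curved on a dense set.

The small factor is `φ = G ∘ ρ`. Here `ρ` is a real-analytic exhaustion function of `U`
(`exists_exhaustion`), the sum of `|x|²` and `∑ₗ 2⁻ˡ Ψ(1 / |x - qₗ|²)` with a dense sequence `qₗ` in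
the complement and a sufficiently fast growing entire function `Ψ`; its analyticity is seen in the
Banach algebra of bounded sequences. The function `G` of one variable is analytic, and it decays
together with its first `k` derivatives as fast as desired (`exists_decaying`): it is a `k`-fold
iterated integral from `t` to `∞` of the reciprocal of a fast growing function, so that derivatives of
`ρ` of any size are compensated.
-/

noncomputable section

namespace LegendreRecovery

/-! ### Entire series and rapidly decaying analytic functions of one variable -/

/-- There are entire power series with nonnegative coefficients that grow as fast as desired. -/
theorem exists_entire_coeff (M : ℕ → ℝ) : ∃ c : ℕ → ℝ, (∀ k, 0 ≤ c k) ∧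
    (∀ r : ℝ, Summable fun k => c k * r ^ k) ∧
    ∀ (m : ℕ) (t : ℝ), (m : ℝ) + 1 ≤ t → M m ≤ ∑' k, c k * t ^ k := by
  have hev : ∀ m : ℕ, ∀ᶠ k : ℕ in atTop, M m ≤ 2 ^ k := fun m =>
    (tendsto_pow_atTop_atTop_of_one_lt (one_lt_two : (1 : ℝ) < 2)).eventually_ge_atTop (M m)
  obtain ⟨s, hs, hM⟩ := extraction_forall_of_eventually hev
  set c : ℕ → ℝ := Function.extend s (fun m => (2 / ((m : ℝ) + 1)) ^ s m) 0 with hc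
  have hcs : ∀ m, c (s m) = (2 / ((m : ℝ) + 1)) ^ s m := fun m => by
    rw [hc, hs.injective.extend_apply]
  have hc0 : ∀ k, k ∉ range s → c k = 0 := fun k hk => by
    rw [hc, Function.extend_apply' _ _ _ (by simpa [mem_range] using hk)]; rfl
  have hcn : ∀ k, 0 ≤ c k := fun k => by
    by_cases hk : k ∈ range s
    · obtain ⟨m, rfl⟩ := hk
      rw [hcs]; positivity
    · rw [hc0 k hk]
  have hsum : ∀ r : ℝ, Summable fun k => c k * r ^ k := by
    intro r
    rw [← hs.injective.summable_iff (fun k hk => by rw [hc0 k hk, zero_mul])]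
    refine Summable.of_norm_bounded_eventually_nat
      (g := fun m : ℕ => (1 / 2 : ℝ) ^ m) summable_geometric_two ?_
    filter_upwards [eventually_ge_atTop ⌈4 * |r|⌉₊] with m hm
    have hm' : 4 * |r| ≤ m := (Nat.le_ceil _).trans (by exact_mod_cast hm)
    have h1 : 2 / ((m : ℝ) + 1) * |r| ≤ 1 / 2 := by
      rw [div_mul_eq_mul_div, div_le_iff₀ (by positivity)]; linarith
    calc ‖((fun k => c k * r ^ k) ∘ s) m‖ = (2 / ((m : ℝ) + 1) * |r|) ^ s m := by
          simp only [Function.comp_apply, hcs, norm_mul, norm_pow, Real.norm_eq_abs, mul_pow]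
          rw [abs_of_nonneg (by positivity)]
      _ ≤ (1 / 2) ^ s m := pow_le_pow_left₀ (by positivity) h1 _
      _ ≤ (1 / 2) ^ m := pow_le_pow_of_le_one (by norm_num) (by norm_num) (hs.id_le m)
  refine ⟨c, hcn, hsum, fun m t hmt => ?_⟩
  have ht : 0 ≤ t := le_trans (by positivity) hmt
  calc M m ≤ 2 ^ s m := hM m
    _ ≤ (2 / ((m : ℝ) + 1) * t) ^ s m := by
        refine pow_le_pow_left₀ (by norm_num) ?_ _
        rw [div_mul_eq_mul_div, le_div_iff₀ (by positivity)]
        exact mul_le_mul_of_nonneg_left hmt (by norm_num)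
    _ = c (s m) * t ^ s m := by rw [hcs, mul_pow]
    _ ≤ ∑' k, c k * t ^ k :=
        (hsum t).le_tsum (s m) fun j _ => mul_nonneg (hcn j) (pow_nonneg ht j)

theorem ofScalars_radius_eq_top {𝕜 : Type*} [RCLike 𝕜] (A : Type*) [NormedRing A]
    [NormedAlgebra 𝕜 A] [NormOneClass A] {c : ℕ → 𝕜}
    (hc : ∀ r : ℝ, Summable fun k => ‖c k‖ * r ^ k) :
    (FormalMultilinearSeries.ofScalars A c).radius = ⊤ := by
  rw [FormalMultilinearSeries.radius_eq_top_iff_summable_norm]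
  intro r
  simpa using hc r

theorem analyticOnNhd_ofScalarsSum {𝕜 : Type*} [RCLike 𝕜] (A : Type*) [NormedRing A]
    [NormedAlgebra 𝕜 A] [NormOneClass A] [CompleteSpace A] {c : ℕ → 𝕜}
    (hc : ∀ r : ℝ, Summable fun k => ‖c k‖ * r ^ k) :
    AnalyticOnNhd 𝕜 (fun a : A => ∑' k, c k • a ^ k) univ := by
  have h := ofScalars_radius_eq_top A hc
  have h1 := (FormalMultilinearSeries.ofScalars A c).hasFPowerSeriesOnBall (by rw [h]; simp)
  rw [h] at h1
  have := h1.analyticOnNhd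
  rw [Metric.eball_top] at this
  rwa [show (fun a : A => ∑' k, c k • a ^ k) = (FormalMultilinearSeries.ofScalars A c).sum from
    (FormalMultilinearSeries.ofScalarsSum_eq_tsum (E := A) c).symm]

/-- `g` extends holomorphically to a complex neighbourhood of each point of the real line. -/
def ExtendsHolomorphically (g : ℝ → ℝ) : Prop :=
  ∀ t : ℝ, ∃ G : ℂ → ℂ, AnalyticAt ℂ G t ∧ ∀ᶠ s : ℝ in 𝓝 t, G s = g s

theorem ExtendsHolomorphically.analyticOnNhd {g : ℝ → ℝ} (hg : ExtendsHolomorphically g) :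
    AnalyticOnNhd ℝ g univ := by
  intro t _
  obtain ⟨G, hG, hGg⟩ := hg t
  have h1 : AnalyticAt ℝ (fun s : ℝ => (G s).re) t :=
    (Complex.reCLM.analyticAt _).comp
      (hG.restrictScalars.comp (Complex.ofRealCLM.analyticAt t))
  refine h1.congr ?_
  filter_upwards [hGg] with s hs
  rw [hs, Complex.ofReal_re]

/-- Antiderivatives inherit holomorphic extensions, because holomorphic functions on discs have
primitives. -/
theorem ExtendsHolomorphically.of_hasDerivAt {g F : ℝ → ℝ} (hg : ExtendsHolomorphically g)
    (hF : ∀ t, HasDerivAt F (g t) t) : ExtendsHolomorphically F := by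
  intro t
  obtain ⟨G, hG, hGg⟩ := hg t
  obtain ⟨r, hr, hball⟩ := Metric.eventually_nhds_iff_ball.1
    hG.eventually_analyticAt
  obtain ⟨r', hr', hball'⟩ := Metric.eventually_nhds_iff_ball.1 hGg
  have hd : DifferentiableOn ℂ G (Metric.ball (t : ℂ) r) := fun z hz =>
    (hball z hz).differentiableAt.differentiableWithinAt
  obtain ⟨P, hP⟩ := hd.isExactOn_ball
  have hPa : AnalyticAt ℂ P t := by
    have : DifferentiableOn ℂ P (Metric.ball (t : ℂ) r) := fun z hz =>
      (hP z hz).differentiableAt.differentiableWithinAt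
    exact this.analyticAt (Metric.ball_mem_nhds _ hr)
  refine ⟨fun z => F t + (P z - P t), by fun_prop, ?_⟩
  have hmem : ∀ s ∈ Metric.ball t (min r r'), (s : ℂ) ∈ Metric.ball (t : ℂ) r := by
    intro s hs
    rw [Metric.mem_ball] at hs ⊢
    rw [Complex.dist_eq, ← Complex.ofReal_sub, Complex.norm_real]
    exact lt_of_lt_of_le hs (min_le_left _ _)
  have hder : ∀ s ∈ Metric.ball t (min r r'),
      HasDerivAt (fun s : ℝ => P s - (F s : ℂ)) 0 s := by
    intro s hs
    have h1 := (hP s (hmem s hs)).comp_ofReal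
    have h2 := (hF s).ofReal_comp
    have h3 := h1.sub h2
    rwa [hball' s (Metric.ball_subset_ball (min_le_right _ _) hs), sub_self] at h3
  filter_upwards [Metric.ball_mem_nhds t (lt_min hr hr')] with s hs
  have hconst := Metric.isOpen_ball.is_const_of_deriv_eq_zero
    ((convex_ball t (min r r')).isPreconnected)
    (fun s hs => (hder s hs).differentiableAt.differentiableWithinAt)
    (fun s hs => (hder s hs).deriv) hs (Metric.mem_ball_self (lt_min hr hr'))
  linear_combination hconst

/-- Every positive sequence has a positive antitone minorant. -/
theorem exists_antitone_pos_le (η : ℕ → ℝ) (hη : ∀ m, 0 < η m) :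
    ∃ ζ : ℕ → ℝ, Antitone ζ ∧ (∀ m, 0 < ζ m) ∧ ∀ m, ζ m ≤ η m := by
  refine ⟨fun m => (Finset.range (m + 1)).inf' (by simp) η, fun a b hab => ?_, fun m => ?_,
    fun m => ?_⟩
  · exact Finset.inf'_mono _ (Finset.range_mono (by omega)) (by simp)
  · rw [Finset.lt_inf'_iff]; exact fun i _ => hη i
  · exact Finset.inf'_le _ (by simp)

open MeasureTheory in
/-- The version of `exists_decaying` that remembers the holomorphic extensions. For `k = 0` the
function is `1 / (C + Ψ²)` with a fast growing entire function `Ψ`. In the induction step, replacing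
`G` by `t ↦ ∫ s in Ioi t, G s` turns control of `k` derivatives into control of `k + 1`. -/
theorem exists_decaying_aux (k : ℕ) : ∀ η : ℕ → ℝ, (∀ m, 0 < η m) →
    ∃ G : ℝ → ℝ, ExtendsHolomorphically G ∧ (∀ t, 0 < G t) ∧
      ∀ i ≤ k, ∀ t, 0 ≤ t → |iteratedDeriv i G t| ≤ η ⌊t⌋₊ := by
  induction k with
  | zero =>
    intro η hη
    obtain ⟨c, hc, hs, hM⟩ := exists_entire_coeff fun m => max 1 (η (m + 1))⁻¹
    set f : ℝ → ℝ := fun t => ∑' k, c k * t ^ k with hf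
    have hpos : ∀ t, 0 < (η 0)⁻¹ + f t ^ 2 := fun t =>
      add_pos_of_pos_of_nonneg (inv_pos.2 (hη 0)) (sq_nonneg _)
    refine ⟨fun t => ((η 0)⁻¹ + f t ^ 2)⁻¹, fun t => ?_, fun t => inv_pos.2 (hpos t), ?_⟩
    · set fc : ℂ → ℂ := fun z => ∑' k, (c k : ℂ) • z ^ k with hfc
      have hfcf : ∀ s : ℝ, fc s = f s := fun s => by
        rw [hf, hfc, Complex.ofReal_tsum]; simp
      have hfa : AnalyticAt ℂ fc t := analyticOnNhd_ofScalarsSum ℂ (c := fun k => (c k : ℂ))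
        (fun r => by simpa [abs_of_nonneg (hc _)] using hs r) t (mem_univ _)
      refine ⟨fun z => (((η 0)⁻¹ : ℝ) + fc z ^ 2)⁻¹, ?_, Eventually.of_forall fun s => ?_⟩
      · refine AnalyticAt.fun_inv (by fun_prop) ?_
        rw [hfcf]
        exact_mod_cast (hpos t).ne'
      · simp only [hfcf]; push_cast; rfl
    · intro i hi t ht
      obtain rfl : i = 0 := by omega
      rw [iteratedDeriv_zero, abs_of_pos (inv_pos.2 (hpos t))]
      rcases Nat.eq_zero_or_pos ⌊t⌋₊ with h0 | h0
      · rw [h0]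
        refine inv_le_of_inv_le₀ (hη 0) ?_
        linarith [sq_nonneg (f t)]
      · obtain ⟨m, hm⟩ : ∃ m, ⌊t⌋₊ = m + 1 := ⟨⌊t⌋₊ - 1, by omega⟩
        have hmt : (m : ℝ) + 1 ≤ t := by
          have := Nat.floor_le ht; rw [hm] at this; exact_mod_cast this
        have h1 := hM m t hmt
        rw [hm]
        refine inv_le_of_inv_le₀ (hη _) ?_
        have h2 : 1 ≤ f t := (le_max_left _ _).trans h1
        have h3 : (η (m + 1))⁻¹ ≤ f t := (le_max_right _ _).trans h1
        nlinarith [inv_pos.2 (hη 0)]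
  | succ k ih =>
    intro η hη
    obtain ⟨ζ, hanti, hζ, hζη⟩ := exists_antitone_pos_le η hη
    obtain ⟨G, hG, hpos, hbd⟩ := ih (fun m => ζ m * Real.exp (-((m : ℝ) + 1)))
      (fun m => mul_pos (hζ m) (Real.exp_pos _))
    have hcont : Continuous G :=
      continuousOn_univ.1 hG.analyticOnNhd.continuousOn
    have hle : ∀ t s, 0 ≤ t → t ≤ s → G s ≤ ζ ⌊t⌋₊ * Real.exp (-s) := by
      intro t s ht hts
      have h := hbd 0 (Nat.zero_le _) s (ht.trans hts)
      rw [iteratedDeriv_zero, abs_of_pos (hpos s)] at h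
      refine h.trans (mul_le_mul (hanti (Nat.floor_mono hts)) (Real.exp_le_exp.2 ?_)
        (Real.exp_pos _).le (hζ _).le)
      linarith [Nat.lt_floor_add_one s]
    have hint0 : IntegrableOn G (Ioi 0) := by
      refine Integrable.mono' ((integrableOn_exp_neg_Ioi 0).const_mul (ζ ⌊(0 : ℝ)⌋₊))
        hcont.aestronglyMeasurable ?_
      filter_upwards [ae_restrict_mem measurableSet_Ioi] with s hs
      rw [Real.norm_eq_abs, abs_of_pos (hpos s)]
      exact hle 0 s le_rfl (le_of_lt hs)
    have hint : ∀ t, IntegrableOn G (Ioi t) := fun t => by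
      rcases le_total 0 t with ht | ht
      · exact hint0.mono_set (Ioi_subset_Ioi ht)
      · rw [← Ioc_union_Ioi_eq_Ioi ht]
        exact ((hcont.integrableOn_Icc).mono_set Ioc_subset_Icc_self).union hint0
    set F : ℝ → ℝ := fun t => ∫ s in Ioi t, G s with hF
    have hFeq : ∀ t, F t = F 0 - ∫ s in (0 : ℝ)..t, G s := fun t => by
      have := intervalIntegral.integral_Ioi_sub_Ioi' (hint 0) (hint t)
      simp only [hF]; linarith
    have hFd : ∀ t, HasDerivAt F (-G t) t := fun t => by
      have h1 : HasDerivAt (fun u => ∫ s in (0 : ℝ)..u, G s) (G t) t :=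
        intervalIntegral.integral_hasDerivAt_right (hcont.intervalIntegrable _ _)
          (hcont.stronglyMeasurableAtFilter _ _) hcont.continuousAt
      have h2 := h1.const_sub (F 0)
      rwa [show F = fun t => F 0 - ∫ s in (0 : ℝ)..t, G s from funext hFeq]
    have hnegG : ExtendsHolomorphically fun t => -G t := fun t => by
      obtain ⟨g, hg, hgG⟩ := hG t
      refine ⟨fun z => -g z, hg.fun_neg, ?_⟩
      filter_upwards [hgG] with s hs
      rw [hs, Complex.ofReal_neg]
    have hFpos : ∀ t, 0 < F t := fun t => by
      rw [hF, setIntegral_pos_iff_support_of_nonneg_ae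
        (Eventually.of_forall fun s => (hpos s).le) (hint t)]
      rw [show Function.support G = univ from eq_univ_of_forall fun s => (hpos s).ne', univ_inter]
      simp
    refine ⟨F, hnegG.of_hasDerivAt hFd, hFpos, fun i hi t ht => ?_⟩
    rcases i with _ | i
    · rw [iteratedDeriv_zero, abs_of_pos (hFpos t)]
      calc F t ≤ ∫ s in Ioi t, ζ ⌊t⌋₊ * Real.exp (-s) := by
            refine setIntegral_mono_on (hint t) ((integrableOn_exp_neg_Ioi t).const_mul _)
              measurableSet_Ioi fun s hs => hle t s ht (le_of_lt hs)
        _ = ζ ⌊t⌋₊ * Real.exp (-t) := by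
            rw [integral_const_mul, integral_exp_neg_Ioi]
        _ ≤ ζ ⌊t⌋₊ * 1 :=
            mul_le_mul_of_nonneg_left (Real.exp_le_one_iff.2 (by linarith)) (hζ _).le
        _ ≤ η ⌊t⌋₊ := by rw [mul_one]; exact hζη _
    · rw [iteratedDeriv_succ', show deriv F = fun t => -G t from funext fun t => (hFd t).deriv,
        iteratedDeriv_fun_neg, abs_neg]
      refine (hbd i (by omega) t ht).trans ?_
      calc _ ≤ ζ ⌊t⌋₊ * 1 := mul_le_mul_of_nonneg_left
            (Real.exp_le_one_iff.2 (by linarith [Nat.cast_nonneg (α := ℝ) ⌊t⌋₊])) (hζ _).le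
        _ ≤ η ⌊t⌋₊ := by rw [mul_one]; exact hζη _

/-- There are positive real-analytic functions on the line which decay at `+∞`, together with any
given number of derivatives, as fast as desired. -/
theorem exists_decaying (k : ℕ) (η : ℕ → ℝ) (hη : ∀ m, 0 < η m) :
    ∃ G : ℝ → ℝ, AnalyticOnNhd ℝ G univ ∧ (∀ t, 0 < G t) ∧
      ∀ i ≤ k, ∀ t, 0 ≤ t → |iteratedDeriv i G t| ≤ η ⌊t⌋₊ := by
  obtain ⟨G, hG, h⟩ := exists_decaying_aux k η hη
  exact ⟨G, hG.analyticOnNhd, h⟩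

/-! ### A real-analytic exhaustion function of an open set -/

open scoped BoundedContinuousFunction

theorem summable_geom_mul (a : ℕ →ᵇ ℝ) : Summable fun l : ℕ => (1 / 2 : ℝ) ^ l * a l :=
  Summable.of_norm_bounded (summable_geometric_two.mul_right ‖a‖) fun l => by
    rw [norm_mul, norm_pow, Real.norm_of_nonneg (by norm_num : (0 : ℝ) ≤ 1 / 2)]
    exact mul_le_mul_of_nonneg_left (a.norm_coe_le_norm l) (by positivity)

/-- The functional `a ↦ ∑ 2⁻ˡ aₗ` on bounded sequences. -/
def geomSum : (ℕ →ᵇ ℝ) →L[ℝ] ℝ :=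
  LinearMap.mkContinuous
    { toFun := fun a => ∑' l : ℕ, (1 / 2 : ℝ) ^ l * a l
      map_add' := fun a b => by
        simp only [BoundedContinuousFunction.coe_add, Pi.add_apply, mul_add]
        exact (summable_geom_mul a).tsum_add (summable_geom_mul b)
      map_smul' := fun r a => by
        simp only [BoundedContinuousFunction.coe_smul, smul_eq_mul, RingHom.id_apply,
          mul_left_comm _ r]
        exact tsum_mul_left }
    2 fun a => by
      refine (tsum_of_norm_bounded (summable_geometric_two.mul_right ‖a‖).hasSum fun l => ?_).trans
        (by rw [tsum_mul_right, tsum_geometric_two])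
      rw [norm_mul, norm_pow, Real.norm_of_nonneg (by norm_num : (0 : ℝ) ≤ 1 / 2)]
      exact mul_le_mul_of_nonneg_left (a.norm_coe_le_norm l) (by positivity)

theorem geomSum_apply (a : ℕ →ᵇ ℝ) : geomSum a = ∑' l : ℕ, (1 / 2 : ℝ) ^ l * a l := rfl

/-- The sequence `1 / |x - qₗ|²`, as an element of the Banach algebra of bounded sequences, depends
analytically on `x` at each point at a positive distance from all the poles `qₗ`. -/
theorem exists_analyticAt_inv_norm_sq {n : ℕ} (q : ℕ → Euc n) (x₀ : Euc n) {d : ℝ} (hd : 0 < d)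
    (hq : ∀ l, d ≤ ‖x₀ - q l‖) : ∃ W : Euc n → (ℕ →ᵇ ℝ), AnalyticAt ℝ W x₀ ∧
      ∀ᶠ x in 𝓝 x₀, ∀ l, W x l = (‖x - q l‖ ^ 2)⁻¹ := by
  have hpos : ∀ l, 0 < ‖x₀ - q l‖ := fun l => hd.trans_le (hq l)
  let β : ℕ →ᵇ ℝ := BoundedContinuousFunction.ofNormedAddCommGroupDiscrete
    (fun l => (‖x₀ - q l‖ ^ 2)⁻¹) (d ^ 2)⁻¹ fun l => by
      rw [Real.norm_of_nonneg (by positivity)]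
      exact inv_anti₀ (by positivity) (pow_le_pow_left₀ hd.le (hq l) 2)
  let γ : Fin n → (ℕ →ᵇ ℝ) := fun i => BoundedContinuousFunction.ofNormedAddCommGroupDiscrete
    (fun l => 2 * (x₀ - q l) i * (‖x₀ - q l‖ ^ 2)⁻¹) (2 * d⁻¹) fun l => by
      have h1 : ‖(x₀ - q l) i‖ ≤ ‖x₀ - q l‖ := PiLp.norm_apply_le _ i
      rw [norm_mul, norm_mul, Real.norm_of_nonneg (by norm_num : (0 : ℝ) ≤ 2),
        Real.norm_of_nonneg (by positivity : 0 ≤ (‖x₀ - q l‖ ^ 2)⁻¹), mul_assoc]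
      refine mul_le_mul_of_nonneg_left ?_ (by norm_num)
      calc _ ≤ ‖x₀ - q l‖ * (‖x₀ - q l‖ ^ 2)⁻¹ :=
            mul_le_mul_of_nonneg_right h1 (by positivity)
        _ = ‖x₀ - q l‖⁻¹ := by
            have := (hpos l).ne'
            field_simp
        _ ≤ d⁻¹ := inv_anti₀ hd (hq l)
  -- `u x` is the sequence of the quotients `|x - qₗ|² / |x₀ - qₗ|²`
  let u : Euc n → (ℕ →ᵇ ℝ) := fun x =>
    1 + ∑ i, (x i - x₀ i) • γ i + (∑ i, (x i - x₀ i) ^ 2) • β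
  have hcoord : ∀ i : Fin n, AnalyticAt ℝ (fun x : Euc n => x i) x₀ := fun i =>
    (EuclideanSpace.proj (𝕜 := ℝ) i : Euc n →L[ℝ] ℝ).analyticAt x₀
  have hu : AnalyticAt ℝ u x₀ := by
    refine (analyticAt_const.add (Finset.univ.analyticAt_fun_sum fun i _ => ?_)).add ?_
    · exact ((hcoord i).sub analyticAt_const).smul analyticAt_const
    · exact (Finset.univ.analyticAt_fun_sum fun i _ =>
        ((hcoord i).sub analyticAt_const).pow 2).smul analyticAt_const
  have hu0 : u x₀ = 1 := by simp [u]
  have hul : ∀ x l, u x l = ‖x - q l‖ ^ 2 * (‖x₀ - q l‖ ^ 2)⁻¹ := by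
    intro x l
    have h1 : u x l = 1 + ∑ i, (x i - x₀ i) * (2 * (x₀ - q l) i * (‖x₀ - q l‖ ^ 2)⁻¹)
        + (∑ i, (x i - x₀ i) ^ 2) * (‖x₀ - q l‖ ^ 2)⁻¹ := by
      simp only [u, BoundedContinuousFunction.coe_add, Pi.add_apply,
        BoundedContinuousFunction.coe_one, Pi.one_apply, BoundedContinuousFunction.coe_sum,
        Finset.sum_apply, BoundedContinuousFunction.coe_smul, smul_eq_mul]
      rfl
    have h2 : ‖x - q l‖ ^ 2 = ‖x₀ - q l‖ ^ 2 + (∑ i, (x i - x₀ i) * (2 * (x₀ - q l) i))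
        + ∑ i, (x i - x₀ i) ^ 2 := by
      simp only [EuclideanSpace.norm_sq_eq, Real.norm_eq_abs, sq_abs, PiLp.sub_apply,
        ← Finset.sum_add_distrib]
      exact Finset.sum_congr rfl fun i _ => by ring
    have h3 : ∑ i, (x i - x₀ i) * (2 * (x₀ - q l) i * (‖x₀ - q l‖ ^ 2)⁻¹) =
        (∑ i, (x i - x₀ i) * (2 * (x₀ - q l) i)) * (‖x₀ - q l‖ ^ 2)⁻¹ := by
      rw [Finset.sum_mul]; exact Finset.sum_congr rfl fun i _ => by ring
    have h4 : ‖x₀ - q l‖ ^ 2 * (‖x₀ - q l‖ ^ 2)⁻¹ = 1 :=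
      mul_inv_cancel₀ (pow_ne_zero 2 (hpos l).ne')
    rw [h1, h2, h3]
    linear_combination -h4
  refine ⟨fun x => β * Ring.inverse (u x), ?_, ?_⟩
  · refine analyticAt_const.mul (AnalyticAt.fun_comp (g := Ring.inverse) ?_ hu)
    rw [hu0]
    exact analyticAt_inverse (𝕜 := ℝ) (1 : (ℕ →ᵇ ℝ)ˣ)
  · have hunit : ∀ᶠ x in 𝓝 x₀, IsUnit (u x) :=
      hu.continuousAt.eventually (by rw [hu0]; exact Units.isOpen.mem_nhds isUnit_one)
    filter_upwards [hunit] with x hx l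
    have h1 : u x l * Ring.inverse (u x) l = 1 := by
      rw [← BoundedContinuousFunction.mul_apply, Ring.mul_inverse_cancel _ hx]; rfl
    have h2 : (β * Ring.inverse (u x)) l = (‖x₀ - q l‖ ^ 2)⁻¹ * Ring.inverse (u x) l := rfl
    rw [hul, mul_assoc] at h1
    rw [h2]
    exact eq_inv_of_mul_eq_one_right h1

theorem analyticAt_norm_sq {n : ℕ} (x : Euc n) : AnalyticAt ℝ (fun y : Euc n => ‖y‖ ^ 2) x :=
  ((contDiff_norm_sq ℝ (n := ⊤)).analyticOnNhd (s := univ)) x (mem_univ _)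

/-- Finitely many members of a dense sequence form an `ε`-net of a bounded part of a closed set. -/
theorem exists_finite_net {n : ℕ} {S : Set (Euc n)} (hS : IsClosed S) (q : ℕ → Euc n)
    (hq : S ⊆ closure (range q)) (R : ℝ) {ε : ℝ} (hε : 0 < ε) :
    ∃ N : ℕ, ∀ y ∈ S, ‖y‖ ≤ R → ∃ l < N, dist y (q l) < ε := by
  have hc : IsCompact (S ∩ Metric.closedBall 0 R) := (isCompact_closedBall _ _).inter_left hS
  obtain ⟨t, ht⟩ := hc.elim_finite_subcover (fun l => Metric.ball (q l) ε)
    (fun l => Metric.isOpen_ball) fun y hy => by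
      obtain ⟨_, ⟨l, rfl⟩, hl⟩ := Metric.mem_closure_iff.1 (hq hy.1) ε hε
      exact mem_iUnion.2 ⟨l, hl⟩
  refine ⟨t.sup id + 1, fun y hy hyR => ?_⟩
  obtain ⟨l, hl, hyl⟩ := mem_iUnion₂.1 (ht ⟨hy, by simpa using hyR⟩)
  exact ⟨l, Nat.lt_succ_of_le (Finset.le_sup (f := id) hl), hyl⟩

/-- Every open set has a real-analytic exhaustion function. It is the sum of `|x|²` and of
`∑ 2⁻ˡ Ψ(1 / |x - qₗ|²)`, where the `qₗ` are dense in the complement and the entire function `Ψ`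
grows so fast that the sum blows up at each point of the boundary. -/
theorem exists_exhaustion {n : ℕ} (U : TopologicalSpace.Opens (Euc n)) :
    ∃ ρ : Euc n → ℝ, AnalyticOnNhd ℝ ρ U ∧ (∀ x ∈ U, 0 ≤ ρ x) ∧
      ∀ m : ℝ, IsCompact {x | x ∈ U ∧ ρ x ≤ m} := by
  have hbdd : ∀ m : ℝ, {x : Euc n | ‖x‖ ^ 2 ≤ m} ⊆ Metric.closedBall 0 (√m) := fun m x hx => by
    simpa using Real.le_sqrt_of_sq_le hx
  rcases eq_empty_or_nonempty ((U : Set (Euc n))ᶜ) with hU | hU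
  · have hU' : ∀ x, x ∈ U := fun x => by
      by_contra hx
      exact (eq_empty_iff_forall_notMem.1 hU) x hx
    refine ⟨fun x => ‖x‖ ^ 2, fun x _ => analyticAt_norm_sq x, fun x _ => by positivity,
      fun m => ?_⟩
    refine (isCompact_closedBall (0 : Euc n) (√m)).of_isClosed_subset ?_
      fun x hx => hbdd m hx.2
    simp only [hU', true_and]
    exact isClosed_le (by fun_prop) continuous_const
  have hScl : IsClosed ((U : Set (Euc n))ᶜ) := U.isOpen.isClosed_compl
  have : Nonempty ↥((U : Set (Euc n))ᶜ) := hU.to_subtype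
  set q : ℕ → Euc n := fun l => (TopologicalSpace.denseSeq ↥((U : Set (Euc n))ᶜ) l : Euc n) with hq
  have hqS : ∀ l, q l ∉ U := fun l => (TopologicalSpace.denseSeq ↥((U : Set (Euc n))ᶜ) l).2
  have hdense : (U : Set (Euc n))ᶜ ⊆ closure (range q) := by
    have h1 := (TopologicalSpace.denseRange_denseSeq ↥((U : Set (Euc n))ᶜ))
    rw [hq, show (fun l => (TopologicalSpace.denseSeq ↥((U : Set (Euc n))ᶜ) l : Euc n)) =
      Subtype.val ∘ TopologicalSpace.denseSeq ↥((U : Set (Euc n))ᶜ) from rfl, range_comp]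
    exact Subtype.dense_iff.1 h1
  choose N hN using fun m : ℕ => exists_finite_net hScl q hdense ((m : ℝ) + 1)
    (show (0 : ℝ) < 1 / (2 * ((m : ℝ) + 1)) by positivity)
  obtain ⟨c, hc, hcs, hcM⟩ := exists_entire_coeff fun m => 2 ^ N m * ((m : ℝ) + 1)
  set Ψ : ℝ → ℝ := fun t => ∑' k, c k * t ^ k with hΨ
  have hΨ0 : ∀ t, 0 ≤ t → 0 ≤ Ψ t := fun t ht =>
    tsum_nonneg fun k => mul_nonneg (hc k) (pow_nonneg ht k)
  set ρ : Euc n → ℝ := fun x =>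
    ‖x‖ ^ 2 + ∑' l : ℕ, (1 / 2 : ℝ) ^ l * Ψ (‖x - q l‖ ^ 2)⁻¹ with hρ
  have hterm : ∀ x l, 0 ≤ (1 / 2 : ℝ) ^ l * Ψ (‖x - q l‖ ^ 2)⁻¹ := fun x l =>
    mul_nonneg (by positivity) (hΨ0 _ (by positivity))
  -- near a point of `U`, the function is the composition of analytic maps of Banach algebras
  have hloc : ∀ x₀ ∈ U, ∃ Z : Euc n → (ℕ →ᵇ ℝ), AnalyticAt ℝ Z x₀ ∧
      ∀ᶠ x in 𝓝 x₀, ∀ l, Z x l = Ψ (‖x - q l‖ ^ 2)⁻¹ := by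
    intro x₀ hx₀
    obtain ⟨d, hd, hball⟩ := Metric.isOpen_iff.1 U.isOpen x₀ hx₀
    have hqd : ∀ l, d ≤ ‖x₀ - q l‖ := fun l => by
      by_contra hlt
      refine hqS l (hball ?_)
      rw [Metric.mem_ball, dist_comm, dist_eq_norm]
      exact not_le.1 hlt
    obtain ⟨W, hW, hWl⟩ := exists_analyticAt_inv_norm_sq q x₀ hd hqd
    have hcn : ∀ r : ℝ, Summable fun k => ‖c k‖ * r ^ k := fun r => by
      simpa only [Real.norm_of_nonneg (hc _)] using hcs r
    have hΦ := analyticOnNhd_ofScalarsSum (𝕜 := ℝ) (ℕ →ᵇ ℝ) hcn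
    refine ⟨fun x => ∑' k, c k • W x ^ k, (hΦ (W x₀) (mem_univ _)).fun_comp hW, ?_⟩
    filter_upwards [hWl] with x hx l
    have hsum : Summable fun k => c k • W x ^ k := by
      refine Summable.of_norm_bounded (hcn ‖W x‖) fun k => ?_
      rw [norm_smul]
      exact mul_le_mul_of_nonneg_left (norm_pow_le _ _) (norm_nonneg _)
    have := (BoundedContinuousFunction.evalCLM ℝ l).map_tsum hsum
    simp only [BoundedContinuousFunction.evalCLM_apply] at this
    rw [this, hΨ]
    refine tsum_congr fun k => ?_
    rw [← hx l]
    simp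
  have hρa : AnalyticOnNhd ℝ ρ U := by
    intro x₀ hx₀
    obtain ⟨Z, hZ, hZl⟩ := hloc x₀ hx₀
    refine ((analyticAt_norm_sq x₀).add ((geomSum.analyticAt _).fun_comp hZ)).congr ?_
    filter_upwards [hZl] with x hx
    simp only [Pi.add_apply, geomSum_apply, hρ, hx]
  have hsumm : ∀ x ∈ U, Summable fun l : ℕ => (1 / 2 : ℝ) ^ l * Ψ (‖x - q l‖ ^ 2)⁻¹ := by
    intro x hx
    obtain ⟨Z, -, hZl⟩ := hloc x hx
    simpa only [hZl.self_of_nhds] using summable_geom_mul (Z x)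
  have hρn : ∀ x, ‖x‖ ^ 2 ≤ ρ x := fun x => le_add_of_nonneg_right (tsum_nonneg (hterm x))
  have hρl : ∀ x ∈ U, ∀ l, (1 / 2 : ℝ) ^ l * Ψ (‖x - q l‖ ^ 2)⁻¹ ≤ ρ x := fun x hx l =>
    ((hsumm x hx).le_tsum l fun j _ => hterm x j).trans (le_add_of_nonneg_left (by positivity))
  refine ⟨ρ, hρa, fun x _ => (by positivity : 0 ≤ ‖x‖ ^ 2).trans (hρn x), fun M => ?_⟩
  refine (isCompact_closedBall (0 : Euc n) (√M)).of_isClosed_subset ?_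
    fun x hx => hbdd M ((hρn x).trans hx.2)
  refine isClosed_of_closure_subset fun x hx => ?_
  by_cases hxU : x ∈ U
  · refine ⟨hxU, ?_⟩
    by_contra hlt
    have hev := (hρa x hxU).continuousAt.eventually (lt_mem_nhds (not_le.1 hlt))
    obtain ⟨y, hy1, hy2⟩ := mem_closure_iff_nhds.1 hx _ hev
    exact absurd hy2.2 (not_le.2 hy1)
  · exfalso
    obtain ⟨m, hm⟩ := exists_nat_ge (max ‖x‖ M)
    have hm1 : ‖x‖ ≤ m := (le_max_left _ _).trans hm
    have hm2 : M ≤ m := (le_max_right _ _).trans hm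
    obtain ⟨l, hl, hxl⟩ := hN m x hxU (by linarith)
    obtain ⟨y, hyK, hxy⟩ := Metric.mem_closure_iff.1 hx (1 / (2 * ((m : ℝ) + 1))) (by positivity)
    have hyq : ‖y - q l‖ < 1 / ((m : ℝ) + 1) := by
      rw [← dist_eq_norm]
      calc dist y (q l) ≤ dist x y + dist x (q l) := by
            rw [dist_comm x y]; exact dist_triangle _ _ _
        _ < 1 / (2 * ((m : ℝ) + 1)) + 1 / (2 * ((m : ℝ) + 1)) := add_lt_add hxy hxl
        _ = 1 / ((m : ℝ) + 1) := by field_simp; norm_num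
    have hypos : 0 < ‖y - q l‖ := by
      rw [norm_pos_iff, sub_ne_zero]
      rintro rfl
      exact hqS l hyK.1
    have ht : (m : ℝ) + 1 ≤ (‖y - q l‖ ^ 2)⁻¹ := by
      refine le_inv_of_le_inv₀ (by positivity) ?_
      calc ‖y - q l‖ ^ 2 ≤ (1 / ((m : ℝ) + 1)) ^ 2 := pow_le_pow_left₀ hypos.le hyq.le 2
        _ ≤ 1 / ((m : ℝ) + 1) := pow_le_of_le_one (by positivity)
            (by rw [div_le_one (by positivity)]; linarith [Nat.cast_nonneg (α := ℝ) m]) two_ne_zero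
        _ = ((m : ℝ) + 1)⁻¹ := one_div _
    have h1 := hρl y hyK.1 l
    have h2 := hcM m _ ht
    have h3 : (m : ℝ) + 1 ≤ (1 / 2 : ℝ) ^ l * Ψ (‖y - q l‖ ^ 2)⁻¹ := by
      calc (m : ℝ) + 1 = (1 / 2 : ℝ) ^ N m * (2 ^ N m * ((m : ℝ) + 1)) := by
            rw [← mul_assoc, ← mul_pow]; norm_num
        _ ≤ (1 / 2 : ℝ) ^ l * Ψ (‖y - q l‖ ^ 2)⁻¹ :=
            mul_le_mul (pow_le_pow_of_le_one (by norm_num) (by norm_num) hl.le) h2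
              (by positivity) (by positivity)
    linarith [hyK.2]

/-! ### Neighbourhoods in the Whitney topology and small perturbations -/

theorem exists_bound_iteratedFDeriv {E F : Type*} [NormedAddCommGroup E] [NormedSpace ℝ E]
    [NormedAddCommGroup F] [NormedSpace ℝ F] [CompleteSpace F] {f : E → F} {U K : Set E}
    (hf : AnalyticOnNhd ℝ f U) (hK : IsCompact K) (hKU : K ⊆ U) (k : ℕ) :
    ∃ C : ℝ, 1 ≤ C ∧ ∀ i ≤ k, ∀ x ∈ K, ‖iteratedFDeriv ℝ i f x‖ ≤ C := by
  choose C hC using fun i : ℕ => hK.exists_bound_of_continuousOn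
    ((hf.iteratedFDeriv i).continuousOn.mono hKU)
  refine ⟨1 + ∑ i ∈ Finset.range (k + 1), |C i|,
    le_add_of_nonneg_right (Finset.sum_nonneg fun _ _ => abs_nonneg _), fun i hi x hx => ?_⟩
  have h1 : |C i| ≤ ∑ i ∈ Finset.range (k + 1), |C i| :=
    Finset.single_le_sum (f := fun i => |C i|) (fun _ _ => abs_nonneg _)
      (Finset.mem_range.2 (by omega))
  linarith [hC i x hx, le_abs_self (C i)]

theorem AnalyticMaps.analyticOnNhd {n m : ℕ} {U : TopologicalSpace.Opens (Euc n)}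
    (f : AnalyticMaps U m) : AnalyticOnNhd ℝ f.toFun U := f.2

/-- An open set in the Whitney topology contains, with each of its elements `f`, all maps whose
derivatives up to some order are close enough to those of `f`, where the closeness required at `x`
depends on the integer part of an exhaustion function. -/
theorem exists_whitney_gauge {n m : ℕ} {U : TopologicalSpace.Opens (Euc n)} {ρ : Euc n → ℝ}
    (hρ : ∀ m : ℝ, IsCompact {x | x ∈ U ∧ ρ x ≤ m}) (f : AnalyticMaps U m)
    {W : Set (AnalyticMaps U m)} (hW : IsOpen W) (hf : f ∈ W) :
    ∃ (k : ℕ) (δ : ℕ → ℝ), (∀ l, 0 < δ l) ∧ ∀ g : AnalyticMaps U m,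
      (∀ x ∈ U, ∀ j ≤ k, ‖iteratedFDeriv ℝ j g.toFun x - iteratedFDeriv ℝ j f.toFun x‖
        ≤ δ ⌊ρ x⌋₊) → g ∈ W := by
  have hW' : TopologicalSpace.GenerateOpen
    {S | ∃ (k : ℕ) (O : Set (Euc n × ((j : Fin (k + 1)) → Euc n [×(j : ℕ)]→L[ℝ] Euc m))),
      IsOpen O ∧ S = {f : AnalyticMaps U m | ∀ x ∈ U, jet k f.toFun x ∈ O}} W := hW
  clear hW
  induction hW' with
  | basic S hS =>
    obtain ⟨k, O, hO, rfl⟩ := hS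
    have hcont : ContinuousOn (jet k f.toFun) U := by
      refine continuousOn_id.prodMk (continuousOn_pi.2 fun j => ?_)
      exact (f.analyticOnNhd.iteratedFDeriv (j : ℕ)).continuousOn
    have hδ : ∀ l : ℕ, ∃ δ > 0, Metric.thickening δ
        (jet k f.toFun '' {x | x ∈ U ∧ ρ x ≤ (l : ℝ) + 1}) ⊆ O := fun l => by
      refine ((hρ _).image_of_continuousOn
        (hcont.mono fun x hx => hx.1)).exists_thickening_subset_open hO ?_
      rintro _ ⟨x, hx, rfl⟩
      exact hf x hx.1
    choose δ hδ0 hδ using hδ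
    refine ⟨k, fun l => δ l / 2, fun l => half_pos (hδ0 l), fun g hg x hx => ?_⟩
    refine hδ ⌊ρ x⌋₊ (Metric.mem_thickening_iff.2
      ⟨jet k f.toFun x, ⟨x, ⟨hx, (Nat.lt_floor_add_one _).le⟩, rfl⟩, ?_⟩)
    refine lt_of_le_of_lt ?_ (half_lt_self (hδ0 ⌊ρ x⌋₊))
    refine max_le ?_ ((dist_pi_le_iff (half_pos (hδ0 _)).le).2 fun j => ?_)
    · simpa [jet] using (half_pos (hδ0 ⌊ρ x⌋₊)).le
    · rw [dist_eq_norm]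
      exact hg x hx j (Nat.lt_succ_iff.1 j.2)
  | univ => exact ⟨0, fun _ => 1, fun _ => one_pos, fun _ _ => mem_univ _⟩
  | inter S T _ _ ihS ihT =>
    obtain ⟨k, δ, hδ, h⟩ := ihS hf.1
    obtain ⟨k', δ', hδ', h'⟩ := ihT hf.2
    refine ⟨max k k', fun l => min (δ l) (δ' l), fun l => lt_min (hδ l) (hδ' l), fun g hg =>
      ⟨h g fun x hx j hj => ?_, h' g fun x hx j hj => ?_⟩⟩
    · exact (hg x hx j (hj.trans (le_max_left _ _))).trans (min_le_left _ _)
    · exact (hg x hx j (hj.trans (le_max_right _ _))).trans (min_le_right _ _)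
  | sUnion 𝒮 _ ih =>
    obtain ⟨S, hS, hfS⟩ := hf
    obtain ⟨k, δ, hδ, h⟩ := ih S hS hfS
    exact ⟨k, δ, hδ, fun g hg => ⟨S, hS, h g hg⟩⟩

/-- A real-analytic map can be made as small as desired, in the sense of the Whitney topology, by
multiplication with a positive real-analytic function. -/
theorem exists_small_multiple {n m : ℕ} {U : TopologicalSpace.Opens (Euc n)} {ρ : Euc n → ℝ}
    (hρa : AnalyticOnNhd ℝ ρ U) (hρ0 : ∀ x ∈ U, 0 ≤ ρ x)
    (hρ : ∀ m : ℝ, IsCompact {x | x ∈ U ∧ ρ x ≤ m}) {L : Euc n → Euc m}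
    (hL : AnalyticOnNhd ℝ L U) (k : ℕ) (δ : ℕ → ℝ) (hδ : ∀ l, 0 < δ l) :
    ∃ φ : Euc n → ℝ, AnalyticOnNhd ℝ φ U ∧ (∀ x, 0 < φ x) ∧
      ∀ x ∈ U, ∀ j ≤ k, ‖iteratedFDeriv ℝ j (fun y => φ y • L y) x‖ ≤ δ ⌊ρ x⌋₊ := by
  choose D hD1 hD using fun l : ℕ =>
    exists_bound_iteratedFDeriv hρa (hρ ((l : ℝ) + 1)) (fun x hx => hx.1) k
  choose B hB1 hB using fun l : ℕ =>
    exists_bound_iteratedFDeriv hL (hρ ((l : ℝ) + 1)) (fun x hx => hx.1) k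
  have hD0 : ∀ l, 0 < D l := fun l => one_pos.trans_le (hD1 l)
  have hB0 : ∀ l, 0 < B l := fun l => one_pos.trans_le (hB1 l)
  set κ : ℕ → ℝ := fun l => 2 ^ k * (k.factorial : ℝ) * D l ^ k * B l with hκ
  have hκ0 : ∀ l, 0 < κ l := fun l => by
    have := hD0 l
    have := hB0 l
    positivity
  obtain ⟨G, hGa, hGpos, hG⟩ := exists_decaying k (fun l => δ l / κ l)
    (fun l => div_pos (hδ l) (hκ0 l))
  have hφa : AnalyticOnNhd ℝ (G ∘ ρ) U := fun x hx => (hGa _ (mem_univ _)).comp (hρa x hx)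
  refine ⟨G ∘ ρ, hφa, fun x => hGpos _, fun x hx j hj => ?_⟩
  set l := ⌊ρ x⌋₊ with hl
  have hxK : x ∈ {x | x ∈ U ∧ ρ x ≤ (l : ℝ) + 1} := ⟨hx, (Nat.lt_floor_add_one _).le⟩
  have hUo := U.isOpen
  have hφ : ∀ i ≤ k, ‖iteratedFDerivWithin ℝ i (G ∘ ρ) U x‖ ≤
      k.factorial * (δ l / κ l) * D l ^ k := by
    intro i hi
    have hδκ : 0 ≤ δ l / κ l := (div_pos (hδ l) (hκ0 l)).le
    refine (norm_iteratedFDerivWithin_comp_le (C := δ l / κ l) (D := D l) (N := i)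
      (hGa.contDiff (𝕜 := ℝ)).contDiffOn hρa.contDiffOn_of_completeSpace le_rfl
      uniqueDiffOn_univ hUo.uniqueDiffOn (mapsTo_univ _ _) hx (fun r hr => ?_)
      (fun r hr hri => ?_)).trans ?_
    · rw [iteratedFDerivWithin_univ, norm_iteratedFDeriv_eq_norm_iteratedDeriv]
      exact hG r (hr.trans hi) _ (hρ0 x hx)
    · rw [iteratedFDerivWithin_of_isOpen r hUo hx]
      exact (hD l r (hri.trans hi) x hxK).trans (le_self_pow₀ (hD1 l) (by omega))
    · have := Nat.factorial_le hi
      have h2 := pow_le_pow_right₀ (hD1 l) hi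
      have h3 : (0 : ℝ) ≤ D l ^ i := pow_nonneg (hD0 l).le _
      gcongr
  rw [← iteratedFDerivWithin_of_isOpen j hUo hx]
  refine (norm_iteratedFDerivWithin_smul_le (N := j) hφa.contDiffOn_of_completeSpace
    hL.contDiffOn_of_completeSpace hUo.uniqueDiffOn hx le_rfl).trans ?_
  calc _ ≤ ∑ i ∈ Finset.range (j + 1), (j.choose i : ℝ) *
        (k.factorial * (δ l / κ l) * D l ^ k) * B l := by
        refine Finset.sum_le_sum fun i hi => ?_
        have hi' : i ≤ j := by simpa [Nat.lt_succ_iff] using hi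
        have h1 := hφ i (hi'.trans hj)
        have h2 : ‖iteratedFDerivWithin ℝ (j - i) L U x‖ ≤ B l := by
          rw [iteratedFDerivWithin_of_isOpen _ hUo hx]
          exact hB l _ (by omega) x hxK
        gcongr
        exact mul_nonneg (Nat.cast_nonneg _) ((norm_nonneg _).trans h1)
    _ = 2 ^ j * (k.factorial * (δ l / κ l) * D l ^ k * B l) := by
        simp only [mul_assoc]
        rw [← Finset.sum_mul]
        norm_cast
        rw [Nat.sum_range_choose]
    _ ≤ 2 ^ k * (k.factorial * (δ l / κ l) * D l ^ k * B l) := by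
        have h1 := hD0 l
        have h2 := hB0 l
        have h3 := div_pos (hδ l) (hκ0 l)
        gcongr
        norm_num
    _ = δ l / κ l * κ l := by rw [hκ]; ring
    _ = δ l := div_mul_cancel₀ _ (hκ0 l).ne'

/-! ### Normal vectors of hypersurfaces and the nondegeneracy determinant -/

section Algebra

/-- For `n` vectors `Aⱼ` and a matrix of vectors `Bᵢⱼ` in `Rⁿ⁺¹`, the determinant of the matrix of
the numbers `det (Bᵢⱼ, A₁, …, Aₙ)`. If the `Aⱼ` and `Bᵢⱼ` are the first and second partial
derivatives of a hypersurface, this is the determinant of its second fundamental form with respect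
to an unnormalized normal vector. -/
def curvDet {R : Type*} [CommRing R] {n : ℕ} (A : Fin n → Fin (n + 1) → R)
    (B : Fin n → Fin n → Fin (n + 1) → R) : R :=
  (Matrix.of fun i j => (Matrix.of (Matrix.vecCons (B i j) A)).det).det

theorem map_curvDet {R S : Type*} [CommRing R] [CommRing S] {n : ℕ} (φ : R →+* S)
    (A : Fin n → Fin (n + 1) → R) (B : Fin n → Fin n → Fin (n + 1) → R) :
    φ (curvDet A B) = curvDet (fun j l => φ (A j l)) (fun i j l => φ (B i j l)) := by
  rw [curvDet, RingHom.map_det, curvDet]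
  congr 1
  ext i j
  simp only [RingHom.mapMatrix_apply, Matrix.map_apply, Matrix.of_apply]
  rw [RingHom.map_det]
  congr 1
  ext a b
  refine Fin.cases ?_ (fun a => ?_) a <;> simp

theorem curvDet_smul {R : Type*} [CommRing R] {n : ℕ} (t : R) (A : Fin n → Fin (n + 1) → R)
    (B : Fin n → Fin n → Fin (n + 1) → R) :
    curvDet (t • A) (t • B) = (t ^ (n + 1)) ^ n * curvDet A B := by
  have h : (Matrix.of fun i j => (Matrix.of (Matrix.vecCons ((t • B) i j) (t • A))).det) =
      t ^ (n + 1) • Matrix.of fun i j => (Matrix.of (Matrix.vecCons (B i j) A)).det := by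
    ext i j
    simp only [Pi.smul_apply, Matrix.of_apply, Matrix.smul_apply, smul_eq_mul]
    rw [← Matrix.smul_cons, ← Matrix.smul_of, Matrix.det_smul, Fintype.card_fin]
  rw [curvDet, h, Matrix.det_smul, Fintype.card_fin, curvDet]

/-- Along a line through a nondegenerate pair the determinant is a nonzero polynomial. -/
theorem finite_setOf_curvDet_eq_zero {n : ℕ} (A₀ A₁ : Fin n → Fin (n + 1) → ℝ)
    (B₀ B₁ : Fin n → Fin n → Fin (n + 1) → ℝ) (h : curvDet A₁ B₁ ≠ 0) :
    {s : ℝ | curvDet (A₁ + s • A₀) (B₁ + s • B₀) = 0}.Finite := by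
  set p : Polynomial ℝ := curvDet
    (fun j l => Polynomial.C (A₁ j l) + Polynomial.X * Polynomial.C (A₀ j l))
    (fun i j l => Polynomial.C (B₁ i j l) + Polynomial.X * Polynomial.C (B₀ i j l)) with hp
  have hev : ∀ s : ℝ, p.eval s = curvDet (A₁ + s • A₀) (B₁ + s • B₀) := fun s => by
    rw [← Polynomial.coe_evalRingHom, hp, map_curvDet]
    congr 1
    · ext j l; simp [mul_comm s]
    · ext i j l; simp [mul_comm s]
  have hp0 : p ≠ 0 := fun h0 => by
    have := hev 0
    rw [h0] at this
    simp at this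
    exact h this.symm
  refine (Polynomial.finite_setOfPred_isRoot hp0).subset fun s hs => ?_
  rw [Set.mem_ofPred_eq, Polynomial.IsRoot, hev]
  exact hs

end Algebra

/-- The generalized cross product of `n` vectors of `ℝⁿ⁺¹`. -/
def normalVec {n : ℕ} (A : Fin n → Euc (n + 1)) : Euc (n + 1) :=
  WithLp.toLp 2 fun l =>
    (-1) ^ (l : ℕ) * (Matrix.of fun i j : Fin n => A i (l.succAbove j)).det

theorem inner_normalVec {n : ℕ} (A : Fin n → Euc (n + 1)) (w : Euc (n + 1)) :
    inner ℝ w (normalVec A) = (Matrix.of (Matrix.vecCons w.ofLp fun j => (A j).ofLp)).det := by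
  rw [Matrix.det_succ_row_zero, PiLp.inner_apply]
  refine Finset.sum_congr rfl fun l _ => ?_
  simp only [normalVec, RCLike.inner_apply, conj_trivial, Matrix.of_apply, Matrix.cons_val_zero]
  have : (Matrix.of fun i j : Fin n => A i (l.succAbove j)) =
      (Matrix.of (Matrix.vecCons w.ofLp fun j => (A j).ofLp)).submatrix Fin.succ l.succAbove := by
    ext i j; simp
  rw [this]
  ring

theorem inner_normalVec_self {n : ℕ} (A : Fin n → Euc (n + 1)) (j : Fin n) :
    inner ℝ (A j) (normalVec A) = 0 := by
  rw [inner_normalVec]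
  refine Matrix.det_zero_of_row_eq (i := 0) (j := j.succ) (Fin.succ_ne_zero j).symm ?_
  ext l
  simp

theorem det_vecCons_ne_zero_iff {n : ℕ} (A : Fin n → Euc (n + 1)) (w : Euc (n + 1)) :
    (Matrix.of (Matrix.vecCons w.ofLp fun j => (A j).ofLp)).det ≠ 0 ↔
      LinearIndependent ℝ A ∧ w ∉ Submodule.span ℝ (range A) := by
  rw [← linearIndependent_finCons, ← isUnit_iff_ne_zero, ← Matrix.isUnit_iff_isUnit_det,
    ← Matrix.linearIndependent_rows_iff_isUnit,
    ← LinearMap.linearIndependent_iff (WithLp.linearEquiv 2 ℝ (Fin (n + 1) → ℝ)).toLinearMap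
      (LinearEquiv.ker _)]
  have : (Matrix.of (Matrix.vecCons w.ofLp fun j => (A j).ofLp)).row =
      ((WithLp.linearEquiv 2 ℝ (Fin (n + 1) → ℝ)).toLinearMap) ∘
        (Fin.cons w A : Fin (n + 1) → Euc (n + 1)) := by
    ext i l
    refine Fin.cases ?_ (fun i => ?_) i <;> simp [Matrix.row]
  rw [this]

theorem normalVec_ne_zero {n : ℕ} {A : Fin n → Euc (n + 1)} (hA : LinearIndependent ℝ A) :
    normalVec A ≠ 0 := by
  have hlt : Submodule.span ℝ (range A) < ⊤ := by
    refine Submodule.lt_top_of_finrank_lt_finrank ?_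
    rw [finrank_span_eq_card hA]
    simp
  obtain ⟨w, -, hw⟩ := SetLike.exists_of_lt hlt
  intro h0
  refine (det_vecCons_ne_zero_iff A w).2 ⟨hA, hw⟩ ?_
  rw [← inner_normalVec, h0, inner_zero_right]

theorem linearIndependent_of_curvDet_ne_zero {n : ℕ} (A : Fin n → Euc (n + 1))
    (B : Fin n → Fin n → Euc (n + 1))
    (h : curvDet (fun j => (A j).ofLp) (fun i j => (B i j).ofLp) ≠ 0) : LinearIndependent ℝ A := by
  rcases Nat.eq_zero_or_pos n with rfl | hn
  · exact linearIndependent_empty_type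
  · by_contra hA
    refine h (Matrix.det_eq_zero_of_row_eq_zero ⟨0, hn⟩ fun j => ?_)
    by_contra hne
    exact hA ((det_vecCons_ne_zero_iff A _).1 hne).1

/-! ### A criterion for pseudo regular frontals -/

theorem euc_eq_sum_single {n : ℕ} (v : Euc n) :
    v = ∑ j, v j • (EuclideanSpace.single j 1 : Euc n) := by
  simpa using ((EuclideanSpace.basisFun (Fin n) ℝ).sum_repr v).symm

theorem clm_apply_eq_sum {n : ℕ} {F : Type*} [NormedAddCommGroup F] [NormedSpace ℝ F]
    (T : Euc n →L[ℝ] F) (v : Euc n) : T v = ∑ j, v j • T (EuclideanSpace.single j 1) := by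
  conv_lhs => rw [euc_eq_sum_single v]
  simp

theorem injective_iff_linearIndependent {n : ℕ} {F : Type*} [NormedAddCommGroup F]
    [NormedSpace ℝ F] (T : Euc n →L[ℝ] F) :
    Function.Injective T ↔ LinearIndependent ℝ fun j => T (EuclideanSpace.single j 1) := by
  rw [Fintype.linearIndependent_iff, injective_iff_map_eq_zero]
  constructor
  · intro h c hc j
    have h1 : T (WithLp.toLp 2 c) = 0 := by rw [clm_apply_eq_sum]; exact hc
    have h2 := h _ h1
    simpa using congrArg (fun v : Euc n => v j) h2
  · intro h v hv
    ext j
    rw [clm_apply_eq_sum] at hv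
    exact h _ hv j

/-- The `j`-th partial derivative. -/
def partialDeriv {n m : ℕ} (g : Euc n → Euc m) (j : Fin n) (x : Euc n) : Euc m :=
  fderiv ℝ g x (EuclideanSpace.single j 1)

/-- The determinant of the second fundamental form of a map `g : ℝⁿ → ℝⁿ⁺¹`, with respect to the
unnormalized normal vector. -/
def secondFormDet {n : ℕ} (g : Euc n → Euc (n + 1)) (x : Euc n) : ℝ :=
  curvDet (fun j => (partialDeriv g j x).ofLp)
    fun i j => (partialDeriv (partialDeriv g j) i x).ofLp

theorem analyticAt_partialDeriv {n m : ℕ} {g : Euc n → Euc m} {x : Euc n}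
    (hg : AnalyticAt ℝ g x) (j : Fin n) : AnalyticAt ℝ (partialDeriv g j) x :=
  ((ContinuousLinearMap.apply ℝ (Euc m) (EuclideanSpace.single j 1 : Euc n)).analyticAt _).fun_comp
    hg.fderiv

theorem analyticOnNhd_partialDeriv {n m : ℕ} {g : Euc n → Euc m} {U : Set (Euc n)}
    (hg : AnalyticOnNhd ℝ g U) (j : Fin n) : AnalyticOnNhd ℝ (partialDeriv g j) U := fun x hx =>
  analyticAt_partialDeriv (hg x hx) j

theorem analyticAt_coord {n m : ℕ} {g : Euc n → Euc m} {x : Euc n} (hg : AnalyticAt ℝ g x)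
    (l : Fin m) : AnalyticAt ℝ (fun y => g y l) x :=
  ((EuclideanSpace.proj (𝕜 := ℝ) l : Euc m →L[ℝ] ℝ).analyticAt _).fun_comp hg

theorem analyticAt_toLp {n m : ℕ} {g : Fin m → Euc n → ℝ} {x : Euc n}
    (hg : ∀ l, AnalyticAt ℝ (g l) x) :
    AnalyticAt ℝ (fun y => (WithLp.toLp 2 fun l => g l y : Euc m)) x :=
  ((PiLp.continuousLinearEquiv 2 ℝ fun _ : Fin m => ℝ).symm.analyticAt _).fun_comp
    (AnalyticAt.pi hg)

theorem analyticAt_det {E : Type*} [NormedAddCommGroup E] [NormedSpace ℝ E] {m : ℕ}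
    {M : E → Matrix (Fin m) (Fin m) ℝ} {x : E} (h : ∀ i j, AnalyticAt ℝ (fun y => M y i j) x) :
    AnalyticAt ℝ (fun y => (M y).det) x := by
  simp only [Matrix.det_apply']
  exact Finset.univ.analyticAt_fun_sum fun σ _ =>
    analyticAt_const.mul (Finset.univ.analyticAt_fun_prod fun i _ => h _ _)

theorem analyticOnNhd_secondFormDet {n : ℕ} {g : Euc n → Euc (n + 1)} {U : Set (Euc n)}
    (hg : AnalyticOnNhd ℝ g U) : AnalyticOnNhd ℝ (secondFormDet g) U := by
  intro x hx
  refine analyticAt_det fun i j => analyticAt_det fun a l => ?_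
  refine Fin.cases ?_ (fun a => ?_) a
  · exact analyticAt_coord
      (analyticOnNhd_partialDeriv (analyticOnNhd_partialDeriv hg j) i x hx) l
  · exact analyticAt_coord (analyticOnNhd_partialDeriv hg a x hx) l

theorem analyticOnNhd_normalVec {n : ℕ} {g : Euc n → Euc (n + 1)} {U : Set (Euc n)}
    (hg : AnalyticOnNhd ℝ g U) :
    AnalyticOnNhd ℝ (fun x => normalVec fun j => partialDeriv g j x) U := fun x hx =>
  analyticAt_toLp fun _ => analyticAt_const.mul
    (analyticAt_det fun i _ => analyticAt_coord (analyticOnNhd_partialDeriv hg i x hx) _)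

theorem mem_regSet_of_secondFormDet_ne_zero {n : ℕ} {g : Euc n → Euc (n + 1)} {U : Set (Euc n)}
    {x : Euc n} (hx : x ∈ U) (h : secondFormDet g x ≠ 0) : x ∈ regSet g U :=
  ⟨hx, (injective_iff_linearIndependent _).2 (linearIndependent_of_curvDet_ne_zero
    (fun j => partialDeriv g j x) (fun i j => partialDeriv (partialDeriv g j) i x) h)⟩

/-- If the second fundamental form is nondegenerate on a dense set, the map is a pseudo regular
frontal: differentiating `∂ⱼf · ν = 0` shows that the kernel of `dν` lies in the kernel of the
second fundamental form. -/
theorem isPseudoRegularFrontal_of_dense {n : ℕ} {U : TopologicalSpace.Opens (Euc n)}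
    (f : AnalyticMaps U (n + 1))
    (h : (U : Set (Euc n)) ⊆ closure {x | x ∈ U ∧ secondFormDet f.toFun x ≠ 0}) :
    IsPseudoRegularFrontal f := by
  set g := f.toFun with hg
  have hga : AnalyticOnNhd ℝ g U := f.analyticOnNhd
  have hsub : {x | x ∈ U ∧ secondFormDet g x ≠ 0} ⊆ regSet g U := fun x hx =>
    mem_regSet_of_secondFormDet_ne_zero hx.1 hx.2
  set N : Euc n → Euc (n + 1) := fun x => normalVec fun j => partialDeriv g j x with hN
  have hN0 : ∀ x ∈ regSet g U, N x ≠ 0 := fun x hx =>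
    normalVec_ne_zero ((injective_iff_linearIndependent _).1 hx.2)
  have hNa : AnalyticOnNhd ℝ N U := analyticOnNhd_normalVec hga
  set ν : Euc n → Euc (n + 1) := fun x => ‖N x‖⁻¹ • N x with hν
  have hνa : AnalyticOnNhd ℝ ν (regSet g U) := fun x hx => by
    have h1 : AnalyticAt ℝ (fun x => ‖N x‖) x :=
      (((hNa x hx.1).contDiffAt (n := ⊤)).norm ℝ (hN0 x hx)).analyticAt
    exact (h1.fun_inv (norm_ne_zero_iff.2 (hN0 x hx))).smul (hNa x hx.1)
  have hνj : ∀ x j, inner ℝ (partialDeriv g j x) (ν x) = 0 := fun x j => by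
    rw [hν, inner_smul_right, inner_normalVec_self (fun j => partialDeriv g j x), mul_zero]
  refine ⟨h.trans (closure_mono hsub), ν, ⟨hνa, fun x hx => ⟨?_, fun v => ?_⟩⟩, ?_⟩
  · rw [hν, norm_smul, norm_inv, norm_norm, inv_mul_cancel₀ (norm_ne_zero_iff.2 (hN0 x hx))]
  · rw [clm_apply_eq_sum, sum_inner]
    refine Finset.sum_eq_zero fun j _ => ?_
    rw [inner_smul_left, show inner ℝ (fderiv ℝ g x (EuclideanSpace.single j 1)) (ν x) = 0 from
      hνj x j, mul_zero]
  · refine fun x hx => closure_mono (fun y hy => ?_) (h hx.1)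
    have hyr := hsub hy
    refine ⟨hyr, (injective_iff_map_eq_zero _).2 fun v hv => ?_⟩
    have hkey : ∀ j, ∑ i, v i * inner ℝ (partialDeriv (partialDeriv g j) i y) (N y) = 0 := by
      intro j
      have hp := (analyticOnNhd_partialDeriv hga j y hy.1).differentiableAt
      have hd := fderiv_inner_apply ℝ hp (hνa y hyr).differentiableAt v
      rw [show (fun t => inner ℝ (partialDeriv g j t) (ν t)) = fun _ => (0 : ℝ) from
        funext fun x => hνj x j, hv, inner_zero_right, zero_add, fderiv_const_apply,
        hν, inner_smul_right, clm_apply_eq_sum (fderiv ℝ (partialDeriv g j) y),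
        sum_inner, zero_apply] at hd
      have h1 := (mul_eq_zero.1 hd.symm).resolve_left
        (inv_ne_zero (norm_ne_zero_iff.2 (hN0 y hyr)))
      simp only [inner_smul_left, conj_trivial] at h1
      exact h1
    have hdet : (Matrix.of fun i j =>
        inner ℝ (partialDeriv (partialDeriv g j) i y) (N y)).det ≠ 0 := by
      simp only [hN, inner_normalVec]
      exact hy.2
    have hz := Matrix.eq_zero_of_vecMul_eq_zero hdet (v := v.ofLp) (by
      ext j
      simpa only [Matrix.vecMul, dotProduct, Matrix.of_apply, Pi.zero_apply] using hkey j)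
    ext j
    exact congrFun hz j

/-! ### Nondegeneracy at a point of maximal distance from the origin -/

/-- The necessary second order condition for a local maximum. -/
theorem second_deriv_nonpos_of_isLocalMax {u u' : ℝ → ℝ} {x c : ℝ} (hmax : IsLocalMax u x)
    (hu : ∀ᶠ s in 𝓝 x, HasDerivAt u (u' s) s) (hu' : HasDerivAt u' c x) : c ≤ 0 := by
  by_contra hc
  have hd : deriv u =ᶠ[𝓝 x] u' := hu.mono fun s hs => hs.deriv
  have hdd : deriv (deriv u) x = c := by rw [hd.deriv_eq, hu'.deriv]
  have hmin := isLocalMin_of_deriv_deriv_pos (f := u) (x₀ := x) (by rw [hdd]; exact not_le.1 hc)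
    hmax.deriv_eq_zero hu.self_of_nhds.continuousAt
  have hconst : u =ᶠ[𝓝 x] fun _ => u x := by
    filter_upwards [hmax, hmin] with s h1 h2 using le_antisymm h1 h2
  have h0 : deriv (deriv u) x = 0 := by
    rw [hconst.deriv.deriv_eq]
    simp
  exact hc (by rw [← hdd, h0])

theorem exists_smul_eq_of_orthogonal {n : ℕ} {A : Fin n → Euc (n + 1)}
    (hA : LinearIndependent ℝ A) {w₁ w₂ : Euc (n + 1)} (h0 : w₁ ≠ 0)
    (h₁ : ∀ j, inner ℝ (A j) w₁ = 0) (h₂ : ∀ j, inner ℝ (A j) w₂ = 0) : ∃ c : ℝ, c • w₁ = w₂ := by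
  set K := Submodule.span ℝ (range A) with hK
  have hmem : ∀ w : Euc (n + 1), (∀ j, inner ℝ (A j) w = 0) → w ∈ Kᗮ := by
    intro w hw
    rw [Submodule.mem_orthogonal]
    intro u hu
    induction hu using Submodule.span_induction with
    | mem x hx => obtain ⟨j, rfl⟩ := hx; exact hw j
    | zero => exact inner_zero_left _
    | add x y _ _ hx hy => rw [inner_add_left, hx, hy, add_zero]
    | smul a x _ hx => rw [inner_smul_left, hx, mul_zero]
  have hfin : Module.finrank ℝ Kᗮ = 1 := by
    have h := Submodule.finrank_add_finrank_orthogonal K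
    have h' : Module.finrank ℝ K = n := by
      rw [hK, finrank_span_eq_card hA, Fintype.card_fin]
    rw [h', finrank_euclideanSpace_fin] at h
    omega
  obtain ⟨c, hc⟩ := (finrank_eq_one_iff_of_nonzero' (⟨w₁, hmem w₁ h₁⟩ : Kᗮ)
    (fun h => h0 (congrArg Subtype.val h))).1 hfin ⟨w₂, hmem w₂ h₂⟩
  exact ⟨c, congrArg Subtype.val hc⟩

/-- An immersed hypersurface is curved at each point whose distance from the origin is locally
maximal, where a sphere touches it from outside: the position vector is normal there, and
`⟨∂ᵢ∂ⱼh, h⟩ ≤ -⟨∂ᵢh, ∂ⱼh⟩` as quadratic forms. -/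
theorem secondFormDet_ne_zero_of_isLocalMax {n : ℕ} {h : Euc n → Euc (n + 1)} {p : Euc n}
    (ha : AnalyticAt ℝ h p) (hinj : Function.Injective (fderiv ℝ h p))
    (hmax : IsLocalMax (fun x => ‖h x‖ ^ 2) p) : secondFormDet h p ≠ 0 := by
  have hLI := (injective_iff_linearIndependent _).1 hinj
  have hd := ha.differentiableAt
  have horth : ∀ j, inner ℝ (partialDeriv h j p) (h p) = 0 := by
    intro j
    have h1 := hmax.fderiv_eq_zero
    have h2 : HasFDerivAt (fun x => ‖h x‖ ^ 2) _ p := hd.hasFDerivAt.norm_sq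
    rw [h2.fderiv] at h1
    have h3 := congrArg (fun T : Euc n →L[ℝ] ℝ => T (EuclideanSpace.single j 1)) h1
    simpa [real_inner_comm, partialDeriv] using h3
  set N := normalVec fun j => partialDeriv h j p with hN
  have hN0 : N ≠ 0 := normalVec_ne_zero hLI
  obtain ⟨c, hc⟩ := exists_smul_eq_of_orthogonal hLI hN0
    (fun j => inner_normalVec_self (fun j => partialDeriv h j p) j) horth
  have hsecond : ∀ v : Euc n, inner ℝ (fderiv ℝ (fun x => fderiv ℝ h x v) p v) (h p) +
      ‖fderiv ℝ h p v‖ ^ 2 ≤ 0 := by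
    intro v
    set X : Euc n → Euc (n + 1) := fun x => fderiv ℝ h x v with hX
    have hXd : DifferentiableAt ℝ X p :=
      (((ContinuousLinearMap.apply ℝ (Euc (n + 1)) v).analyticAt _).fun_comp
        ha.fderiv).differentiableAt
    have hline : ∀ s : ℝ, HasDerivAt (fun s : ℝ => p + s • v) v s := fun s => by
      simpa using ((hasDerivAt_id s).smul_const v).const_add p
    have hcont : Tendsto (fun s : ℝ => p + s • v) (𝓝 0) (𝓝 p) := by
      have := (hline 0).continuousAt.tendsto
      simpa using this
    have hmax' : IsLocalMax (fun s : ℝ => ‖h (p + s • v)‖ ^ 2) 0 := by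
      have := hcont.eventually hmax
      simpa [IsLocalMax, IsMaxFilter] using this
    have hp0 : p = p + (0 : ℝ) • v := by simp
    have hder : ∀ᶠ s : ℝ in 𝓝 0, HasDerivAt (fun s : ℝ => ‖h (p + s • v)‖ ^ 2)
        (2 * inner ℝ (h (p + s • v)) (X (p + s • v))) s := by
      filter_upwards [hcont.eventually ha.eventually_analyticAt] with s hs
      exact (hs.differentiableAt.hasFDerivAt.comp_hasDerivAt s (hline s)).norm_sq
    have hXl : HasDerivAt (fun s : ℝ => X (p + s • v)) (fderiv ℝ X p v) 0 := by
      have hX0 : HasFDerivAt X (fderiv ℝ X p) (p + (0 : ℝ) • v) := by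
        rw [← hp0]; exact hXd.hasFDerivAt
      have := hX0.comp_hasDerivAt (0 : ℝ) (hline 0)
      exact this
    have hhl : HasDerivAt (fun s : ℝ => h (p + s • v)) (X p) 0 :=
      HasFDerivAt.comp_hasDerivAt 0 (by rw [← hp0]; exact hd.hasFDerivAt) (hline 0)
    have hder2 := ((hhl.inner ℝ hXl).const_mul 2)
    have := second_deriv_nonpos_of_isLocalMax hmax' hder hder2
    rw [← hp0, real_inner_self_eq_norm_sq, real_inner_comm] at this
    linarith
  intro h0
  have hdet : (Matrix.of fun i j =>
      inner ℝ (partialDeriv (partialDeriv h j) i p) N).det = 0 := by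
    simp only [hN, inner_normalVec]
    exact h0
  obtain ⟨v, hv0, hv⟩ := Matrix.exists_mulVec_eq_zero_iff.2 hdet
  have hvi : ∀ i, ∑ j, v j * inner ℝ (partialDeriv (partialDeriv h j) i p) N = 0 := fun i => by
    have := congrFun hv i
    simpa only [Matrix.mulVec, dotProduct, Matrix.of_apply, Pi.zero_apply, mul_comm] using this
  set v' : Euc n := WithLp.toLp 2 v with hv'
  have hpd : ∀ j, DifferentiableAt ℝ (partialDeriv h j) p := fun j =>
    (analyticAt_partialDeriv ha j).differentiableAt
  have hXeq : (fun x => fderiv ℝ h x v') = fun x => ∑ j, v j • partialDeriv h j x :=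
    funext fun x => clm_apply_eq_sum _ _
  have hform : inner ℝ (fderiv ℝ (fun x => fderiv ℝ h x v') p v') (h p) = 0 := by
    rw [hXeq, fderiv_fun_sum (A := fun j x => v j • partialDeriv h j x)
      fun j _ => (hpd j).const_smul (v j), clm_apply_eq_sum, sum_inner]
    refine Finset.sum_eq_zero fun i _ => ?_
    have hi := hvi i
    rw [inner_smul_left, ← hc, inner_smul_right, sum_apply, sum_inner]
    rw [show ∑ j, inner ℝ (fderiv ℝ (fun x => v j • partialDeriv h j x) p
        (EuclideanSpace.single i 1)) N =
        ∑ j, v j * inner ℝ (partialDeriv (partialDeriv h j) i p) N from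
      Finset.sum_congr rfl fun j _ => by
        rw [fderiv_fun_const_smul (hpd j)]
        simp [inner_smul_left, partialDeriv], hi]
    simp
  have hle := hsecond v'
  rw [hform, zero_add] at hle
  have hz : fderiv ℝ h p v' = 0 := by
    rw [← norm_eq_zero]
    exact pow_eq_zero_iff two_ne_zero |>.1 (le_antisymm hle (sq_nonneg _))
  have hv'0 := (injective_iff_map_eq_zero _).1 hinj v' hz
  exact hv0 (by ext j; simpa [hv'] using congrArg (fun w : Euc n => w j) hv'0)

/-- An immersion of an open set which tends to zero at the boundary and at infinity is curved on a
dense set, because each connected component contains a point of maximal norm. -/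
theorem dense_secondFormDet_ne_zero {n : ℕ} {U : TopologicalSpace.Opens (Euc n)}
    {h : Euc n → Euc (n + 1)} (ha : AnalyticOnNhd ℝ h U)
    (hinj : ∀ x ∈ U, Function.Injective (fderiv ℝ h x)) (hne : ∀ x ∈ U, h x ≠ 0)
    (hcpt : ∀ ε > 0, ∃ K, IsCompact K ∧ K ⊆ U ∧ ∀ x ∈ U, x ∉ K → ‖h x‖ < ε) :
    (U : Set (Euc n)) ⊆ closure {x | x ∈ U ∧ secondFormDet h x ≠ 0} := by
  intro x hx
  by_contra hcl
  have hzero : secondFormDet h =ᶠ[𝓝 x] 0 := by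
    filter_upwards [isClosed_closure.isOpen_compl.mem_nhds hcl, U.isOpen.mem_nhds hx] with y hy hyU
    by_contra hne
    exact hy (subset_closure ⟨hyU, hne⟩)
  set C := connectedComponentIn (U : Set (Euc n)) x with hC
  have hCU : C ⊆ U := connectedComponentIn_subset _ _
  have hCo : IsOpen C := U.isOpen.connectedComponentIn
  have hCzero : EqOn (secondFormDet h) 0 C :=
    ((analyticOnNhd_secondFormDet ha).mono hCU).eqOn_zero_of_preconnected_of_eventuallyEq_zero
      isPreconnected_connectedComponentIn (mem_connectedComponentIn hx) hzero
  have hcont : Continuous fun y : (U : Set (Euc n)) => ‖h y‖ ^ 2 :=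
    (continuousOn_iff_continuous_domRestrict.1 ha.continuousOn).norm.pow 2
  obtain ⟨K, hK, hKU, hKs⟩ := hcpt ‖h x‖ (norm_pos_iff.2 (hne x hx))
  have hK' : IsCompact ((↑) ⁻¹' K : Set (U : Set (Euc n))) := by
    rw [Subtype.isCompact_iff, Subtype.image_preimage_coe, inter_eq_right.2 hKU]
    exact hK
  obtain ⟨p, hp, hpmax⟩ := hcont.continuousOn.exists_isMaxOn'
    (isClosed_connectedComponent (x := (⟨x, hx⟩ : (U : Set (Euc n))))) mem_connectedComponent (by
      refine Eventually.filter_mono inf_le_left ?_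
      filter_upwards [hK'.compl_mem_cocompact] with y hy
      exact pow_le_pow_left₀ (norm_nonneg _) (hKs y y.2 hy).le 2)
  have hCimg : C = (↑) '' connectedComponent (⟨x, hx⟩ : (U : Set (Euc n))) :=
    connectedComponentIn_eq_image hx
  have hpC : (p : Euc n) ∈ C := hCimg ▸ mem_image_of_mem _ hp
  have hloc : IsLocalMax (fun y => ‖h y‖ ^ 2) (p : Euc n) := by
    filter_upwards [hCo.mem_nhds hpC] with y hy
    rw [hCimg] at hy
    obtain ⟨y', hy', rfl⟩ := hy
    exact hpmax hy'
  exact secondFormDet_ne_zero_of_isLocalMax (ha p p.2) (hinj p p.2) hloc (hCzero hpC)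

/-! ### Density of the pseudo regular frontals -/

/-- The affine embedding `x ↦ (1, x)`. -/
def affineEmb {n : ℕ} (x : Euc n) : Euc (n + 1) :=
  WithLp.toLp 2 fun l => (Fin.cons 1 x.ofLp : Fin (n + 1) → ℝ) l

theorem analyticOnNhd_affineEmb {n : ℕ} (U : Set (Euc n)) :
    AnalyticOnNhd ℝ (affineEmb (n := n)) U := fun x _ =>
  analyticAt_toLp (g := fun l x => (Fin.cons 1 x.ofLp : Fin (n + 1) → ℝ) l) fun l => by
    refine Fin.cases ?_ (fun i => ?_) l
    · exact analyticAt_const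
    · exact analyticAt_coord analyticAt_id i

/-- A positive multiple of the affine embedding is an immersion. -/
theorem injective_fderiv_smul_affineEmb {n : ℕ} {φ : Euc n → ℝ} {x : Euc n}
    (hφ : AnalyticAt ℝ φ x) (hpos : 0 < φ x) :
    Function.Injective (fderiv ℝ (fun y => φ y • affineEmb y) x) := by
  refine (injective_iff_map_eq_zero _).2 fun v hv => ?_
  have hd : DifferentiableAt ℝ (fun y => φ y • affineEmb y) x :=
    (hφ.smul (analyticOnNhd_affineEmb univ x (mem_univ x))).differentiableAt
  have hcoord : ∀ l, fderiv ℝ (fun y => (φ y • affineEmb y : Euc (n + 1)) l) x v = 0 := fun l => by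
    have h1 := ((EuclideanSpace.proj (𝕜 := ℝ) l : Euc (n + 1) →L[ℝ] ℝ).hasFDerivAt).comp x
      hd.hasFDerivAt
    have h2 : HasFDerivAt (fun y => (φ y • affineEmb y : Euc (n + 1)) l) _ x := h1
    rw [h2.fderiv, ContinuousLinearMap.comp_apply, hv, map_zero]
  have h0 : fderiv ℝ φ x v = 0 := by
    have := hcoord 0
    simpa [affineEmb] using this
  ext i
  have h1 := hcoord i.succ
  simp only [affineEmb, PiLp.smul_apply, Fin.cons_succ, smul_eq_mul] at h1
  have h2 : HasFDerivAt (fun y : Euc n => y i) (EuclideanSpace.proj (𝕜 := ℝ) i) x :=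
    (EuclideanSpace.proj (𝕜 := ℝ) i : Euc n →L[ℝ] ℝ).hasFDerivAt
  have h3 : HasFDerivAt (fun y : Euc n => φ y * y i) _ x :=
    hφ.differentiableAt.hasFDerivAt.mul h2
  rw [h3.fderiv] at h1
  simp [h0, hpos.ne'] at h1
  simpa using h1

/-- The element of `A(U, ℝᵐ)` given by a map which is real-analytic on `U`. -/
def AnalyticMaps.ofAnalyticOnNhd {n m : ℕ} {U : TopologicalSpace.Opens (Euc n)}
    (g : Euc n → Euc m) (hg : AnalyticOnNhd ℝ g U) : AnalyticMaps U m :=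
  ⟨fun x => g x, fun x hx => (hg x hx).congr (by
    filter_upwards [U.isOpen.mem_nhds hx] with y hy
    exact (Subtype.val_injective.extend_apply (fun x : U => g x) 0 ⟨y, hy⟩).symm)⟩

theorem AnalyticMaps.toFun_ofAnalyticOnNhd {n m : ℕ} {U : TopologicalSpace.Opens (Euc n)}
    (g : Euc n → Euc m) (hg : AnalyticOnNhd ℝ g U) :
    EqOn (AnalyticMaps.ofAnalyticOnNhd g hg).toFun g U := fun y hy =>
  Subtype.val_injective.extend_apply (fun x : U => g x) 0 ⟨y, hy⟩

theorem partialDeriv_congr {n m : ℕ} {f g : Euc n → Euc m} {U : Set (Euc n)} (hU : IsOpen U)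
    (h : EqOn f g U) (j : Fin n) : EqOn (partialDeriv f j) (partialDeriv g j) U := fun x hx => by
  rw [partialDeriv, (h.eventuallyEq_of_mem (hU.mem_nhds hx)).fderiv_eq, partialDeriv]

theorem secondFormDet_congr {n : ℕ} {f g : Euc n → Euc (n + 1)} {U : Set (Euc n)} (hU : IsOpen U)
    (h : EqOn f g U) : EqOn (secondFormDet f) (secondFormDet g) U := fun x hx => by
  have h1 := fun j => partialDeriv_congr hU h j
  have h2 := fun i j => partialDeriv_congr hU (h1 j) i hx
  simp only [secondFormDet, h1 _ hx, h2]

theorem partialDeriv_add_smul {n m : ℕ} {f g : Euc n → Euc m} {U : Set (Euc n)}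
    (hf : AnalyticOnNhd ℝ f U) (hg : AnalyticOnNhd ℝ g U) (t : ℝ) (j : Fin n) :
    EqOn (partialDeriv (f + t • g) j) (partialDeriv f j + t • partialDeriv g j) U := fun x hx => by
  have h1 := (hf x hx).differentiableAt
  have h2 := (hg x hx).differentiableAt
  rw [partialDeriv, fderiv_add h1 (h2.const_smul t), fderiv_const_smul h2]
  rfl

/-- For all but finitely many `s ≠ 0`, the perturbation `f + s⁻¹ h` is curved at a point where `h`
is: up to a power of `s`, the determinant is that of `h + s f`, a polynomial in `s` which does not
vanish at `0`. -/
theorem finite_setOf_secondFormDet_add_smul_eq_zero {n : ℕ} {f h : Euc n → Euc (n + 1)} {U : Set (Euc n)}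
    (hU : IsOpen U) (hf : AnalyticOnNhd ℝ f U) (hh : AnalyticOnNhd ℝ h U) {x : Euc n} (hx : x ∈ U)
    (hx0 : secondFormDet h x ≠ 0) :
    {s : ℝ | s ≠ 0 ∧ secondFormDet (f + s⁻¹ • h) x = 0}.Finite := by
  refine (finite_setOf_curvDet_eq_zero (fun j => (partialDeriv f j x).ofLp) _
    (fun i j => (partialDeriv (partialDeriv f j) i x).ofLp) _ hx0).subset ?_
  rintro s ⟨hs, hs0⟩
  have h1 : ∀ j, partialDeriv (f + s⁻¹ • h) j x =
      s⁻¹ • (partialDeriv h j x + s • partialDeriv f j x) := fun j => by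
    rw [partialDeriv_add_smul hf hh _ j hx, smul_add, smul_smul, inv_mul_cancel₀ hs, one_smul]
    exact add_comm _ _
  have h2 : ∀ i j, partialDeriv (partialDeriv (f + s⁻¹ • h) j) i x =
      s⁻¹ • (partialDeriv (partialDeriv h j) i x + s • partialDeriv (partialDeriv f j) i x) :=
    fun i j => by
    rw [partialDeriv_congr hU (partialDeriv_add_smul hf hh s⁻¹ j) i hx,
      partialDeriv_add_smul (analyticOnNhd_partialDeriv hf j) (analyticOnNhd_partialDeriv hh j) _ i
        hx, smul_add, smul_smul, inv_mul_cancel₀ hs, one_smul]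
    exact add_comm _ _
  have h3 : secondFormDet (f + s⁻¹ • h) x = curvDet
      (s⁻¹ • ((fun j => (partialDeriv h j x).ofLp) + s • fun j => (partialDeriv f j x).ofLp))
      (s⁻¹ • ((fun i j => (partialDeriv (partialDeriv h j) i x).ofLp) +
        s • fun i j => (partialDeriv (partialDeriv f j) i x).ofLp)) := by
    simp only [secondFormDet, h1, h2]
    rfl
  rw [h3, curvDet_smul] at hs0
  exact (mul_eq_zero.1 hs0).resolve_left (pow_ne_zero _ (pow_ne_zero _ (inv_ne_zero hs)))

/-- Every real-analytic map is perturbed into a pseudo regular frontal by adding a small multiple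
of a sufficiently small immersion, because only countably many multiples are exceptional. -/
theorem dense_isPseudoRegularFrontal {n : ℕ} (U : TopologicalSpace.Opens (Euc n)) :
    Dense {f : AnalyticMaps U (n + 1) | IsPseudoRegularFrontal f} := by
  rw [dense_iff_inter_open]
  rintro W hW ⟨f, hfW⟩
  obtain ⟨ρ, hρa, hρ0, hρ⟩ := exists_exhaustion U
  obtain ⟨k, δ, hδ, hgauge⟩ := exists_whitney_gauge hρ f hW hfW
  -- the factor `1 / (l + 1)` makes the perturbation tend to zero at the boundary of `U`
  obtain ⟨φ, hφa, hφpos, hφ⟩ := exists_small_multiple hρa hρ0 hρ (analyticOnNhd_affineEmb (U : Set (Euc n))) k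
    (fun l => min (δ l) (1 / ((l : ℝ) + 1))) fun l => lt_min (hδ l) (by positivity)
  set h : Euc n → Euc (n + 1) := fun y => φ y • affineEmb y with hh
  have hha : AnalyticOnNhd ℝ h U := fun x hx =>
    (hφa x hx).smul (analyticOnNhd_affineEmb U x hx)
  have hfa := f.analyticOnNhd
  have hdense : (U : Set (Euc n)) ⊆ closure {x | x ∈ U ∧ secondFormDet h x ≠ 0} := by
    refine dense_secondFormDet_ne_zero hha
      (fun x hx => injective_fderiv_smul_affineEmb (hφa x hx) (hφpos x)) (fun x hx h0 => ?_)
      fun ε hε => ?_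
    · have := congrArg (fun w : Euc (n + 1) => w 0) h0
      simp [hh, affineEmb, (hφpos x).ne'] at this
    · obtain ⟨l, hl⟩ := exists_nat_one_div_lt hε
      refine ⟨_, hρ l, fun x hx => hx.1, fun x hx hxK => ?_⟩
      have hlx : l ≤ ⌊ρ x⌋₊ := Nat.le_floor (not_le.1 fun hle => hxK ⟨hx, hle⟩).le
      have h1 := hφ x hx 0 (Nat.zero_le _)
      rw [norm_iteratedFDeriv_zero] at h1
      refine (h1.trans (min_le_right _ _)).trans_lt (lt_of_le_of_lt ?_ hl)
      exact Nat.one_div_le_one_div hlx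
  -- a countable dense set of test points replaces a choice of one point in each component
  obtain ⟨Q, hQsub, hQc, hQd⟩ := (TopologicalSpace.IsSeparable.of_separableSpace
    {x | x ∈ U ∧ secondFormDet h x ≠ 0}).exists_countable_dense_subset
  have hbad : (⋃ x ∈ Q, {s : ℝ | s ≠ 0 ∧ secondFormDet (f.toFun + s⁻¹ • h) x = 0}).Countable :=
    hQc.biUnion fun x hx => (finite_setOf_secondFormDet_add_smul_eq_zero U.isOpen hfa
      hha (hQsub hx).1 (hQsub hx).2).countable
  obtain ⟨s, hs1, hs⟩ := (hbad.dense_compl ℝ).inter_open_nonempty (Ioi 1) isOpen_Ioi ⟨2, by simp⟩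
  have hs1' : (1 : ℝ) < s := hs1
  have hs0 : s ≠ 0 := by positivity
  have hga : AnalyticOnNhd ℝ (f.toFun + s⁻¹ • h) U := fun x hx =>
    (hfa x hx).add (analyticAt_const.smul (hha x hx))
  refine ⟨AnalyticMaps.ofAnalyticOnNhd _ hga, hgauge _ fun x hx j hj => ?_,
    isPseudoRegularFrontal_of_dense _ ?_⟩
  · have heq : (AnalyticMaps.ofAnalyticOnNhd _ hga).toFun =ᶠ[𝓝 x] f.toFun + s⁻¹ • h :=
      (AnalyticMaps.toFun_ofAnalyticOnNhd _ hga).eventuallyEq_of_mem (U.isOpen.mem_nhds hx)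
    have hsm : ContDiffAt ℝ j (s⁻¹ • h) x := by
      have := (hha x hx).contDiffAt (n := j) |>.const_smul s⁻¹
      exact this
    rw [(EventuallyEq.iteratedFDeriv ℝ heq j).self_of_nhds,
      iteratedFDeriv_add_apply (hfa x hx).contDiffAt hsm,
      iteratedFDeriv_const_smul_apply (hha x hx).contDiffAt, add_sub_cancel_left, norm_smul]
    calc ‖s⁻¹‖ * ‖iteratedFDeriv ℝ j h x‖ ≤ 1 * ‖iteratedFDeriv ℝ j h x‖ := by
          refine mul_le_mul_of_nonneg_right ?_ (norm_nonneg _)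
          rw [norm_inv, Real.norm_of_nonneg (by positivity)]
          exact inv_le_one_of_one_le₀ hs1'.le
      _ ≤ δ ⌊ρ x⌋₊ := by
          rw [one_mul]
          exact (hφ x hx j hj).trans (min_le_left _ _)
  · refine hdense.trans (closure_minimal (hQd.trans (closure_mono fun x hx => ?_))
      isClosed_closure)
    refine ⟨(hQsub hx).1, fun h0 => hs (mem_biUnion hx ⟨hs0, ?_⟩)⟩
    rw [← secondFormDet_congr U.isOpen (AnalyticMaps.toFun_ofAnalyticOnNhd _ hga) (hQsub hx).1]
    exact h0

/-! ### Spherical coordinates -/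

/-- Dropping the first coordinate. -/
def dropFirst {n : ℕ} : Euc (n + 1) →L[ℝ] Euc n :=
  LinearMap.toContinuousLinearMap
    { toFun := fun x => WithLp.toLp 2 fun i => x i.succ
      map_add' := fun _ _ => rfl
      map_smul' := fun _ _ => rfl }

theorem dropFirst_apply {n : ℕ} (x : Euc (n + 1)) (i : Fin n) : dropFirst x i = x i.succ := rfl

theorem analyticOnNhd_sph {n : ℕ} : AnalyticOnNhd ℝ (sph (n := n)) univ := fun θ _ => by
  have hcos : ∀ i : Fin n, AnalyticAt ℝ (fun y : Euc n => Real.cos (y i)) θ := fun i =>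
    Real.analyticAt_cos.fun_comp (analyticAt_coord analyticAt_id i)
  have hsin : ∀ i : Fin n, AnalyticAt ℝ (fun y : Euc n => Real.sin (y i)) θ := fun i =>
    Real.analyticAt_sin.fun_comp (analyticAt_coord analyticAt_id i)
  refine analyticAt_toLp (g := fun l θ => (Fin.cons (∏ i, Real.cos (θ i))
    (fun j : Fin n => Real.sin (θ j.rev) * ∏ i ∈ Finset.Iio j.rev, Real.cos (θ i)) :
      Fin (n + 1) → ℝ) l) fun l => ?_
  refine Fin.cases ?_ (fun j => ?_) l
  · exact Finset.univ.analyticAt_fun_prod fun i _ => hcos i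
  · exact (hsin _).mul ((Finset.Iio j.rev).analyticAt_fun_prod fun i _ => hcos i)

theorem sph_castSucc {n : ℕ} (θ : Euc (n + 1)) (l : Fin (n + 1)) :
    sph θ l.castSucc = Real.cos (θ 0) * sph (dropFirst θ) l := by
  refine Fin.cases ?_ (fun j => ?_) l
  · simp [sph, Fin.prod_univ_succ, dropFirst_apply]
  · have h : Finset.Iio j.rev.succ =
        insert 0 ((Finset.Iio j.rev).map (Fin.succEmb n)) := by
      ext i
      refine Fin.cases ?_ (fun i => ?_) i
      · simp
      · simp
    simp only [sph, ← Fin.succ_castSucc, Fin.cons_succ, Fin.rev_castSucc, h, dropFirst_apply]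
    rw [Finset.prod_insert (by simp), Finset.prod_map]
    simp only [Fin.coe_succEmb]
    ring

theorem sph_last {n : ℕ} (θ : Euc (n + 1)) : sph θ (Fin.last (n + 1)) = Real.sin (θ 0) := by
  have h : Finset.Iio (0 : Fin (n + 1)) = ∅ := by ext i; simp
  simp [sph, ← Fin.succ_last, h]

theorem norm_sph {n : ℕ} (θ : Euc n) : ‖sph θ‖ = 1 := by
  have h : ‖sph θ‖ ^ 2 = 1 := by
    induction n with
    | zero => simp [sph, EuclideanSpace.norm_sq_eq]
    | succ n ih =>
      have h1 := ih (dropFirst θ)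
      rw [EuclideanSpace.norm_sq_eq] at h1 ⊢
      simp only [Real.norm_eq_abs, sq_abs] at h1 ⊢
      rw [Fin.sum_univ_castSucc]
      simp only [sph_castSucc, sph_last, mul_pow]
      rw [← Finset.mul_sum, h1, mul_one, Real.cos_sq_add_sin_sq]
  nlinarith [norm_nonneg (sph θ)]

theorem differentiableAt_sph {n : ℕ} (θ : Euc n) : DifferentiableAt ℝ (sph (n := n)) θ :=
  (analyticOnNhd_sph θ (mem_univ _)).differentiableAt

theorem inner_sph_fderiv_sph {n : ℕ} (θ v : Euc n) : inner ℝ (sph θ) (fderiv ℝ sph θ v) = 0 := by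
  have h1 : HasFDerivAt (fun y : Euc n => ‖sph y‖ ^ 2) _ θ :=
    (differentiableAt_sph θ).hasFDerivAt.norm_sq
  have h2 : HasFDerivAt (fun y : Euc n => ‖sph y‖ ^ 2) (0 : Euc n →L[ℝ] ℝ) θ := by
    simp only [norm_sph]
    exact hasFDerivAt_const _ _
  have h3 := congrArg (fun T : Euc n →L[ℝ] ℝ => T v) (h1.unique h2)
  simpa using h3

theorem fderiv_coord {n m : ℕ} {g : Euc n → Euc m} {x : Euc n} (hg : DifferentiableAt ℝ g x)
    (v : Euc n) (l : Fin m) : (fderiv ℝ g x v) l = fderiv ℝ (fun y => g y l) x v := by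
  have h2 : HasFDerivAt (fun y => g y l) _ x :=
    ((EuclideanSpace.proj (𝕜 := ℝ) l : Euc m →L[ℝ] ℝ).hasFDerivAt).comp x hg.hasFDerivAt
  rw [h2.fderiv]
  rfl

theorem fderiv_sph_castSucc {n : ℕ} (θ v : Euc (n + 1)) (l : Fin (n + 1)) :
    fderiv ℝ sph θ v l.castSucc = -Real.sin (θ 0) * v 0 * sph (dropFirst θ) l +
      Real.cos (θ 0) * fderiv ℝ sph (dropFirst θ) (dropFirst v) l := by
  rw [fderiv_coord (differentiableAt_sph θ)]
  simp only [sph_castSucc]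
  have h0 : HasFDerivAt (fun y : Euc (n + 1) => y 0) (EuclideanSpace.proj (𝕜 := ℝ) 0) θ :=
    (EuclideanSpace.proj (𝕜 := ℝ) 0 : Euc (n + 1) →L[ℝ] ℝ).hasFDerivAt
  have h1 : HasFDerivAt (fun y : Euc (n + 1) => sph (dropFirst y) l) _ θ :=
    ((EuclideanSpace.proj (𝕜 := ℝ) l : Euc (n + 1) →L[ℝ] ℝ).hasFDerivAt).comp θ
      ((differentiableAt_sph (dropFirst θ)).hasFDerivAt.comp θ dropFirst.hasFDerivAt)
  have h2 : HasFDerivAt (fun y : Euc (n + 1) => Real.cos (y 0) * sph (dropFirst y) l) _ θ :=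
    h0.cos.mul h1
  rw [h2.fderiv]
  simp
  ring

theorem fderiv_sph_last {n : ℕ} (θ v : Euc (n + 1)) :
    fderiv ℝ sph θ v (Fin.last (n + 1)) = Real.cos (θ 0) * v 0 := by
  rw [fderiv_coord (differentiableAt_sph θ)]
  simp only [sph_last]
  have h0 : HasFDerivAt (fun y : Euc (n + 1) => y 0) (EuclideanSpace.proj (𝕜 := ℝ) 0) θ :=
    (EuclideanSpace.proj (𝕜 := ℝ) 0 : Euc (n + 1) →L[ℝ] ℝ).hasFDerivAt
  rw [h0.sin.fderiv]
  simp

theorem dropFirst_single_zero {n : ℕ} :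
    dropFirst (EuclideanSpace.single (0 : Fin (n + 1)) (1 : ℝ)) = 0 := by
  ext i
  simp [dropFirst_apply, Fin.succ_ne_zero]

theorem dropFirst_single_succ {n : ℕ} (j : Fin n) :
    dropFirst (EuclideanSpace.single j.succ (1 : ℝ)) = EuclideanSpace.single j 1 := by
  ext i
  simp [dropFirst_apply]

theorem coordField_zero_castSucc {n : ℕ} (θ : Euc (n + 1)) (l : Fin (n + 1)) :
    coordField θ 0 l.castSucc = -Real.sin (θ 0) * sph (dropFirst θ) l := by
  rw [coordField, fderiv_sph_castSucc, dropFirst_single_zero]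
  simp

theorem coordField_succ_castSucc {n : ℕ} (θ : Euc (n + 1)) (j : Fin n) (l : Fin (n + 1)) :
    coordField θ j.succ l.castSucc = Real.cos (θ 0) * coordField (dropFirst θ) j l := by
  rw [coordField, fderiv_sph_castSucc, dropFirst_single_succ]
  simp [coordField, (Fin.succ_ne_zero j).symm]

theorem coordField_succ_last {n : ℕ} (θ : Euc (n + 1)) (j : Fin n) :
    coordField θ j.succ (Fin.last (n + 1)) = 0 := by
  rw [coordField, fderiv_sph_last]
  simp [(Fin.succ_ne_zero j).symm]

theorem inner_sph_coordField {n : ℕ} (θ : Euc n) (j : Fin n) :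
    inner ℝ (sph θ) (coordField θ j) = 0 := inner_sph_fderiv_sph _ _

theorem inner_eq_sum_castSucc {n : ℕ} (x y : Euc (n + 1)) :
    inner ℝ x y = (∑ l : Fin n, x l.castSucc * y l.castSucc) +
      x (Fin.last n) * y (Fin.last n) := by
  rw [PiLp.inner_apply, Fin.sum_univ_castSucc]
  simp [mul_comm]

/-- Spherical coordinates are orthogonal. -/
theorem inner_coordField_of_ne {n : ℕ} (θ : Euc n) {i j : Fin n} (hij : i ≠ j) :
    inner ℝ (coordField θ i) (coordField θ j) = 0 := by
  induction n with
  | zero => exact i.elim0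
  | succ n ih =>
    have hzero : ∀ k : Fin n, inner ℝ (coordField θ 0) (coordField θ k.succ) = 0 := fun k => by
      have h := inner_sph_coordField (dropFirst θ) k
      rw [PiLp.inner_apply] at h
      simp only [RCLike.inner_apply, conj_trivial] at h
      rw [inner_eq_sum_castSucc]
      simp only [coordField_zero_castSucc, coordField_succ_castSucc, coordField_succ_last,
        mul_zero, add_zero]
      calc _ = -Real.sin (θ 0) * Real.cos (θ 0) *
            ∑ l, coordField (dropFirst θ) k l * sph (dropFirst θ) l := by
            rw [Finset.mul_sum]
            exact Finset.sum_congr rfl fun l _ => by ring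
        _ = 0 := by rw [h, mul_zero]
    induction i using Fin.cases with
    | zero =>
      induction j using Fin.cases with
      | zero => exact absurd rfl hij
      | succ j => exact hzero j
    | succ i =>
      induction j using Fin.cases with
      | zero => rw [real_inner_comm]; exact hzero i
      | succ j =>
        have h := ih (dropFirst θ) (i := i) (j := j) fun h => hij (by rw [h])
        rw [PiLp.inner_apply] at h
        simp only [RCLike.inner_apply, conj_trivial] at h
        rw [inner_eq_sum_castSucc]
        simp only [coordField_succ_castSucc, coordField_succ_last, mul_zero, add_zero]
        calc _ = Real.cos (θ 0) ^ 2 *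
              ∑ l, coordField (dropFirst θ) j l * coordField (dropFirst θ) i l := by
              rw [Finset.mul_sum]
              exact Finset.sum_congr rfl fun l _ => by ring
          _ = 0 := by rw [h, mul_zero]

theorem fderiv_sph_apply {n : ℕ} (θ v : Euc n) :
    fderiv ℝ sph θ v = ∑ j, v j • coordField θ j := clm_apply_eq_sum _ _

theorem injective_fderiv_sph_iff {n : ℕ} (θ : Euc n) :
    Function.Injective (fderiv ℝ sph θ) ↔ ∀ j, coordField θ j ≠ 0 := by
  rw [injective_iff_linearIndependent]
  refine ⟨fun h j => h.ne_zero j, fun h => ?_⟩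
  exact linearIndependent_of_ne_zero_of_inner_eq_zero h fun i j hij => inner_coordField_of_ne θ hij

theorem coordField_zero_ne_zero {n : ℕ} (j : Fin n) : coordField (0 : Euc n) j ≠ 0 := by
  induction n with
  | zero => exact j.elim0
  | succ n ih =>
    intro h
    induction j using Fin.cases with
    | zero =>
      have h1 := congrArg (fun w : Euc (n + 2) => w (Fin.last (n + 1))) h
      simp [coordField, fderiv_sph_last] at h1
    | succ j =>
      refine ih j ?_
      ext l
      have h1 := congrArg (fun w : Euc (n + 2) => w l.castSucc) h
      simpa [coordField_succ_castSucc] using h1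

/-- Where the coordinate fields do not vanish, spherical coordinates have an analytic local
inverse. It is the angular part of the inverse of the polar coordinates `(θ, r) ↦ r sph θ`. -/
theorem exists_local_angle {n : ℕ} {t : Euc n} (ht : ∀ j, coordField t j ≠ 0) :
    ∃ ϑ : Euc (n + 1) → Euc n, AnalyticAt ℝ ϑ (sph t) ∧ ϑ (sph t) = t ∧
      ∀ᶠ w in 𝓝 (sph t), ‖w‖ = 1 → sph (ϑ w) = w := by
  set Φ : Euc n × ℝ → Euc (n + 1) := fun q => q.2 • sph q.1 with hΦ
  have hΦa : AnalyticAt ℝ Φ (t, 1) :=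
    analyticAt_snd.smul ((analyticOnNhd_sph t (mem_univ _)).fun_comp analyticAt_fst)
  have hsph : HasFDerivAt (fun q : Euc n × ℝ => sph q.1)
      ((fderiv ℝ sph t).comp (ContinuousLinearMap.fst ℝ (Euc n) ℝ)) (t, 1) :=
    HasFDerivAt.comp (g := sph) (f := Prod.fst) (t, (1 : ℝ)) (differentiableAt_sph t).hasFDerivAt
      hasFDerivAt_fst
  have hΦd : HasFDerivAt Φ _ (t, 1) :=
    (hasFDerivAt_snd (𝕜 := ℝ) (p := (t, (1 : ℝ)))).smul hsph
  have hval : ∀ q : Euc n × ℝ, fderiv ℝ Φ (t, 1) q = fderiv ℝ sph t q.1 + q.2 • sph t := fun q => by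
    rw [hΦd.fderiv]
    simp
  have hinj : Function.Injective (fderiv ℝ Φ (t, 1)) := by
    refine (injective_iff_map_eq_zero _).2 fun q hq => ?_
    rw [hval] at hq
    have h1 := congrArg (inner ℝ (sph t)) hq
    rw [inner_add_right, inner_sph_fderiv_sph, inner_smul_right, real_inner_self_eq_norm_sq,
      norm_sph, inner_zero_right] at h1
    have hq2 : q.2 = 0 := by simpa using h1
    rw [hq2, zero_smul, add_zero] at hq
    exact Prod.ext ((injective_iff_map_eq_zero _).1 ((injective_fderiv_sph_iff t).2 ht) _ hq) hq2
  set e : (Euc n × ℝ) ≃L[ℝ] Euc (n + 1) :=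
    (LinearEquiv.ofInjectiveOfFinrankEq (fderiv ℝ Φ (t, 1)).toLinearMap hinj
      (by simp)).toContinuousLinearEquiv with he
  have hed : HasFDerivAt Φ (e : (Euc n × ℝ) →L[ℝ] Euc (n + 1)) (t, 1) := by
    have hee : (e : (Euc n × ℝ) →L[ℝ] Euc (n + 1)) = fderiv ℝ Φ (t, 1) :=
      ContinuousLinearMap.ext fun q => rfl
    rw [hee]
    exact hΦa.differentiableAt.hasFDerivAt
  have hcd : ContDiffAt ℝ ⊤ Φ (t, 1) := hΦa.contDiffAt
  have hst : HasStrictFDerivAt Φ (e : (Euc n × ℝ) →L[ℝ] Euc (n + 1)) (t, 1) :=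
    hcd.hasStrictFDerivAt' hed (by simp)
  have hΦt : Φ (t, 1) = sph t := by simp [hΦ]
  set Λ := hcd.localInverse hed (by simp) with hΛ
  have hΛa : AnalyticAt ℝ Λ (sph t) := by
    rw [← hΦt]
    exact (hcd.to_localInverse hed (by simp)).analyticAt
  have hΛt : Λ (sph t) = (t, 1) := by
    rw [← hΦt]
    exact hcd.localInverse_apply_image hed (by simp)
  have hinv : ∀ᶠ w in 𝓝 (sph t), Φ (Λ w) = w := by
    rw [← hΦt]
    exact hst.eventually_right_inverse
  refine ⟨fun w => (Λ w).1, analyticAt_fst.fun_comp hΛa, by simp [hΛt], ?_⟩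
  have hpos : ∀ᶠ w in 𝓝 (sph t), 0 < (Λ w).2 := by
    have hc : ContinuousAt (fun w => (Λ w).2) (sph t) :=
      continuous_snd.continuousAt.comp hΛa.continuousAt
    exact hc.eventually (lt_mem_nhds (by simp [hΛt]))
  filter_upwards [hinv, hpos] with w hw hw0 hw1
  have hr : (Λ w).2 = 1 := by
    have := congrArg norm hw
    rw [hΦ, norm_smul, norm_sph, mul_one, hw1, Real.norm_of_nonneg hw0.le] at this
    exact this
  have hw' : (Λ w).2 • sph (Λ w).1 = w := hw
  rwa [hr, one_smul] at hw'

/-! ### Gauss mappings of the regular part -/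

theorem normalVec_ne_zero_iff {n : ℕ} (A : Fin n → Euc (n + 1)) :
    normalVec A ≠ 0 ↔ LinearIndependent ℝ A := by
  refine ⟨fun h => ?_, normalVec_ne_zero⟩
  refine ((det_vecCons_ne_zero_iff A (normalVec A)).1 ?_).1
  rw [← inner_normalVec]
  exact inner_self_ne_zero.2 h

theorem isOpen_regSet {n : ℕ} {g : Euc n → Euc (n + 1)} {V : Set (Euc n)} (hV : IsOpen V)
    (hg : AnalyticOnNhd ℝ g V) : IsOpen (regSet g V) := by
  have h : regSet g V = V ∩ (fun x => normalVec fun j => partialDeriv g j x) ⁻¹' {0}ᶜ := by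
    ext x
    rw [regSet, Set.mem_ofPred_eq, injective_iff_linearIndependent, mem_inter_iff, mem_preimage,
      mem_compl_singleton_iff, normalVec_ne_zero_iff]
    rfl
  rw [h]
  exact (analyticOnNhd_normalVec hg).continuousOn.isOpen_inter_preimage hV isOpen_compl_singleton

/-- Two Gauss mappings of an immersed hypersurface agree locally up to a sign. -/
theorem IsGaussMap.eventuallyEq_or_neg {n : ℕ} {f ν₀ ν₁ : Euc n → Euc (n + 1)} {V : Set (Euc n)}
    (hV : IsOpen V) (hreg : ∀ x ∈ V, Function.Injective (fderiv ℝ f x)) (h₀ : IsGaussMap f V ν₀)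
    (h₁ : IsGaussMap f V ν₁) {x : Euc n} (hx : x ∈ V) :
    ν₀ =ᶠ[𝓝 x] ν₁ ∨ ν₀ =ᶠ[𝓝 x] -ν₁ := by
  have hsign : ∀ y ∈ V, ∃ c : ℝ, c • ν₁ y = ν₀ y ∧ (c = 1 ∨ c = -1) ∧
      inner ℝ (ν₁ y) (ν₀ y) = c := by
    intro y hy
    obtain ⟨c, hc⟩ := exists_smul_eq_of_orthogonal
      ((injective_iff_linearIndependent _).1 (hreg y hy))
      (norm_ne_zero_iff.1 (by rw [(h₁.2 y hy).1]; exact one_ne_zero))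
      (fun j => (h₁.2 y hy).2 _) (fun j => (h₀.2 y hy).2 _)
    refine ⟨c, hc, ?_, ?_⟩
    · have h := congrArg norm hc
      rw [norm_smul, (h₁.2 y hy).1, (h₀.2 y hy).1, mul_one, Real.norm_eq_abs] at h
      exact eq_or_eq_neg_of_abs_eq h
    · rw [← hc, inner_smul_right, real_inner_self_eq_norm_sq, (h₁.2 y hy).1]
      simp
  have hcont : ContinuousAt (fun y => inner ℝ (ν₁ y) (ν₀ y)) x :=
    (h₁.1 x hx).continuousAt.inner (h₀.1 x hx).continuousAt
  obtain ⟨c, -, hc, hcx⟩ := hsign x hx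
  rcases hc with rfl | rfl
  · left
    filter_upwards [hV.mem_nhds hx, hcont.eventually (lt_mem_nhds (hcx ▸ one_pos))] with y hy hpos
    obtain ⟨c, hcy, rfl | rfl, hci⟩ := hsign y hy
    · rw [← hcy, one_smul]
    · rw [hci] at hpos; norm_num at hpos
  · right
    filter_upwards [hV.mem_nhds hx,
      hcont.eventually (gt_mem_nhds (hcx ▸ (by norm_num : (-1 : ℝ) < 0)))] with y hy hneg
    obtain ⟨c, hcy, rfl | rfl, hci⟩ := hsign y hy
    · rw [hci] at hneg; norm_num at hneg
    · rw [← hcy, Pi.neg_apply, neg_one_smul]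

theorem IsGaussMap.regSet_eq {n : ℕ} {f ν₀ ν₁ : Euc n → Euc (n + 1)} {V : Set (Euc n)}
    (hV : IsOpen V) (hreg : ∀ x ∈ V, Function.Injective (fderiv ℝ f x)) (h₀ : IsGaussMap f V ν₀)
    (h₁ : IsGaussMap f V ν₁) : regSet ν₀ V = regSet ν₁ V := by
  ext x
  refine and_congr_right fun hx => ?_
  rcases h₀.eventuallyEq_or_neg hV hreg h₁ hx with h | h
  · rw [h.fderiv_eq]
  · rw [h.fderiv_eq, fderiv_neg]
    exact neg_injective.of_comp_iff _

/-! ### Recovery from the Legendre data -/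

/-- Near a point `y`, the maps `ν` and `a = f · ν` are the Legendre data of an immersion `f`, and
`ν` is regular at `y`. -/
structure IsRegularDatum {n : ℕ} (f ν : Euc n → Euc (n + 1)) (a : Euc n → ℝ) (y : Euc n) :
    Prop where
  differentiableAt : DifferentiableAt ℝ f y
  analyticAt : AnalyticAt ℝ ν y
  norm_eq_one : ∀ᶠ z in 𝓝 y, ‖ν z‖ = 1
  inner_fderiv : ∀ v, inner ℝ (fderiv ℝ f y v) (ν y) = 0
  support_eq : ∀ᶠ z in 𝓝 y, a z = inner ℝ (f z) (ν z)
  injective : Function.Injective (fderiv ℝ ν y)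

/-- Spherical coordinates with prescribed rotation and prescribed nondegenerate angles. -/
theorem IsRegularDatum.exists_lift {n : ℕ} {f ν : Euc n → Euc (n + 1)} {a : Euc n → ℝ} {y : Euc n}
    (h : IsRegularDatum f ν a y) (R : Euc (n + 1) ≃ₗᵢ[ℝ] Euc (n + 1)) {t : Euc n}
    (ht : t ∈ angleCube n) (htc : ∀ j, coordField t j ≠ 0) (hy : ν y = R (sph t)) :
    ∃ θ, IsSphericalLift ν y R θ ∧ θ y = t := by
  obtain ⟨ϑ, hϑa, hϑt, hϑ⟩ := exists_local_angle htc
  have hRy : R.symm (ν y) = sph t := by rw [hy, R.symm_apply_apply]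
  have hRa : AnalyticAt ℝ (fun z => R.symm (ν z)) y :=
    (R.symm.toContinuousLinearEquiv.analyticAt _).fun_comp h.analyticAt
  refine ⟨fun z => ϑ (R.symm (ν z)), ⟨?_, ?_, ?_⟩, ?_⟩
  · exact AnalyticAt.fun_comp (by rwa [hRy]) hRa
  · simpa only [hRy, hϑt] using ht
  · have hev := hRa.continuousAt.eventually (p := fun w => ‖w‖ = 1 → sph (ϑ w) = w)
      (by simpa only [hRy] using hϑ)
    filter_upwards [hev, h.norm_eq_one] with z hz hz1
    rw [hz (by rw [R.symm.norm_map, hz1]), R.apply_symm_apply]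
  · simp only [hRy, hϑt]

theorem zero_mem_angleCube (n : ℕ) : (0 : Euc n) ∈ angleCube n := fun _ =>
  ⟨neg_lt_zero.2 Real.pi_pos, Real.pi_pos⟩

/-- A rotation moving the base point `sph 0` to `ν y` reduces to the nondegenerate angles `0`. -/
theorem IsRegularDatum.exists_rotation_lift {n : ℕ} {f ν : Euc n → Euc (n + 1)} {a : Euc n → ℝ}
    {y : Euc n} (h : IsRegularDatum f ν a y) : ∃ R θ, IsSphericalLift ν y R θ := by
  have hn : ‖sph (0 : Euc n)‖ = ‖ν y‖ := by rw [norm_sph, h.norm_eq_one.self_of_nhds]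
  obtain ⟨θ, hθ, -⟩ := h.exists_lift (Submodule.reflection (ℝ ∙ (sph (0 : Euc n) - ν y))ᗮ)
    (zero_mem_angleCube n) coordField_zero_ne_zero (Submodule.reflection_sub hn).symm
  exact ⟨_, θ, hθ⟩

theorem IsSphericalLift.fderiv_eq {n : ℕ} {ν : Euc n → Euc (n + 1)} {y : Euc n}
    {R : Euc (n + 1) ≃ₗᵢ[ℝ] Euc (n + 1)} {θ : Euc n → Euc n} (hl : IsSphericalLift ν y R θ)
    (v : Euc n) : fderiv ℝ ν y v = R (fderiv ℝ sph (θ y) (fderiv ℝ θ y v)) := by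
  have h1 : HasFDerivAt (fun z => sph (θ z)) _ y :=
    (differentiableAt_sph (θ y)).hasFDerivAt.comp y hl.1.differentiableAt.hasFDerivAt
  have h2 : HasFDerivAt (fun z => R (sph (θ z))) _ y :=
    R.toContinuousLinearEquiv.hasFDerivAt.comp y h1
  have h3 : ν =ᶠ[𝓝 y] fun z => R (sph (θ z)) := hl.2.2
  rw [h3.fderiv_eq, h2.fderiv]
  rfl

/-- The angles of a regular Gauss mapping form a local diffeomorphism. -/
theorem IsRegularDatum.bijective_fderiv_angle {n : ℕ} {f ν : Euc n → Euc (n + 1)}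
    {a : Euc n → ℝ} {y : Euc n} (h : IsRegularDatum f ν a y)
    {R : Euc (n + 1) ≃ₗᵢ[ℝ] Euc (n + 1)} {θ : Euc n → Euc n} (hl : IsSphericalLift ν y R θ) :
    Function.Bijective (fderiv ℝ θ y) := by
  have hinj : Function.Injective (fderiv ℝ θ y) := by
    refine (injective_iff_map_eq_zero _).2 fun v hv => ?_
    refine (injective_iff_map_eq_zero _).1 h.injective v ?_
    rw [hl.fderiv_eq, hv, map_zero, map_zero]
  exact ⟨hinj, (LinearMap.injective_iff_surjective
    (f := (fderiv ℝ θ y : Euc n →ₗ[ℝ] Euc n))).1 hinj⟩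

theorem IsRegularDatum.coordField_ne_zero {n : ℕ} {f ν : Euc n → Euc (n + 1)}
    {a : Euc n → ℝ} {y : Euc n} (h : IsRegularDatum f ν a y)
    {R : Euc (n + 1) ≃ₗᵢ[ℝ] Euc (n + 1)} {θ : Euc n → Euc n} (hl : IsSphericalLift ν y R θ) :
    ∀ j, coordField (θ y) j ≠ 0 := by
  rw [← injective_fderiv_sph_iff]
  refine (injective_iff_map_eq_zero _).2 fun w hw => ?_
  obtain ⟨v, rfl⟩ := (h.bijective_fderiv_angle hl).2 w
  have hv : v = 0 := (injective_iff_map_eq_zero _).1 h.injective v (by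
    rw [hl.fderiv_eq, hw, map_zero])
  rw [hv, map_zero]

/-- The linear system determines the components of `f` along the coordinate fields: differentiate
`a = f · ν` and use that `df` is orthogonal to `ν`. -/
theorem IsRegularDatum.solvesSystem_iff {n : ℕ} {f ν : Euc n → Euc (n + 1)}
    {a : Euc n → ℝ} {y : Euc n} (h : IsRegularDatum f ν a y)
    {R : Euc (n + 1) ≃ₗᵢ[ℝ] Euc (n + 1)} {θ : Euc n → Euc n} (hl : IsSphericalLift ν y R θ)
    (b : Fin n → ℝ) :
    SolvesSystem a θ y b ↔ b = fun j => inner ℝ (f y) (R (coordField (θ y) j)) := by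
  have ha : ∀ v, fderiv ℝ a y v =
      ∑ j, fderiv ℝ θ y v j * inner ℝ (f y) (R (coordField (θ y) j)) := fun v => by
    have h1 : a =ᶠ[𝓝 y] fun z => inner ℝ (f z) (ν z) := h.support_eq
    rw [h1.fderiv_eq, fderiv_inner_apply ℝ h.differentiableAt h.analyticAt.differentiableAt,
      h.inner_fderiv, add_zero, hl.fderiv_eq, fderiv_sph_apply, map_sum, inner_sum]
    refine Finset.sum_congr rfl fun j _ => ?_
    rw [map_smul, inner_smul_right]
  have hb : ∀ v, (∑ j, b j • fderiv ℝ (fun z => θ z j) y) v = ∑ j, fderiv ℝ θ y v j * b j :=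
    fun v => by
    rw [sum_apply]
    refine Finset.sum_congr rfl fun j _ => ?_
    rw [fderiv_coord hl.1.differentiableAt, mul_comm]
    rfl
  constructor
  · intro hs
    ext j
    obtain ⟨v, hv⟩ := (h.bijective_fderiv_angle hl).2 (EuclideanSpace.single j 1)
    have h1 := ha v
    rw [SolvesSystem] at hs
    rw [hs, hb, hv] at h1
    simpa using h1
  · rintro rfl
    ext v
    rw [ha, hb]

/-- The expansion of a vector in the orthogonal basis formed by a point of the sphere and the
coordinate fields there. -/
theorem sph_expansion {n : ℕ} {θ : Euc n} (hθ : ∀ j, coordField θ j ≠ 0) (x : Euc (n + 1)) :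
    inner ℝ x (sph θ) • sph θ + ∑ j, (inner ℝ x (coordField θ j) / ‖coordField θ j‖) •
      (‖coordField θ j‖⁻¹ • coordField θ j) = x := by
  set w := x - (inner ℝ x (sph θ) • sph θ + ∑ j, (inner ℝ x (coordField θ j) / ‖coordField θ j‖) •
      (‖coordField θ j‖⁻¹ • coordField θ j)) with hw
  have hsph : inner ℝ (sph θ) w = 0 := by
    rw [hw, inner_sub_right, inner_add_right, inner_smul_right, real_inner_self_eq_norm_sq,
      norm_sph, inner_sum, Finset.sum_eq_zero fun j _ => by
        rw [inner_smul_right, inner_smul_right, inner_sph_coordField, mul_zero, mul_zero],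
      real_inner_comm]
    ring
  have hcf : ∀ i, inner ℝ (coordField θ i) w = 0 := fun i => by
    have hi : ‖coordField θ i‖ ≠ 0 := norm_ne_zero_iff.2 (hθ i)
    rw [hw, inner_sub_right, inner_add_right, inner_smul_right,
      real_inner_comm (sph θ) (coordField θ i),
      inner_sph_coordField, inner_sum, Finset.sum_eq_single i (fun j _ hj => by
        rw [inner_smul_right, inner_smul_right, inner_coordField_of_ne θ hj.symm, mul_zero,
          mul_zero]) (by simp), inner_smul_right, inner_smul_right, real_inner_self_eq_norm_sq,
      real_inner_comm x (coordField θ i)]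
    field_simp
    ring
  have hLI : LinearIndependent ℝ fun j => coordField θ j :=
    (injective_iff_linearIndependent _).1 ((injective_fderiv_sph_iff θ).2 hθ)
  obtain ⟨c, hc⟩ := exists_smul_eq_of_orthogonal hLI (w₁ := sph θ)
    (norm_ne_zero_iff.1 (by rw [norm_sph]; exact one_ne_zero))
    (fun j => by rw [real_inner_comm]; exact inner_sph_coordField θ j) hcf
  rw [← hc, inner_smul_right, real_inner_self_eq_norm_sq, norm_sph] at hsph
  have hc0 : c = 0 := by simpa using hsph
  rw [hc0, zero_smul] at hc
  exact (sub_eq_zero.1 hc.symm).symm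

theorem IsRegularDatum.recoveryFormula_eq {n : ℕ} {f ν : Euc n → Euc (n + 1)}
    {a : Euc n → ℝ} {y : Euc n} (h : IsRegularDatum f ν a y)
    {R : Euc (n + 1) ≃ₗᵢ[ℝ] Euc (n + 1)} {θ : Euc n → Euc n} (hl : IsSphericalLift ν y R θ)
    {b : Fin n → ℝ} (hb : SolvesSystem a θ y b) : recoveryFormula ν a y R θ b = f y := by
  have hR : ∀ w, inner ℝ (f y) (R w) = inner ℝ (R.symm (f y)) w := fun w => by
    rw [← R.symm.inner_map_map (f y) (R w), R.symm_apply_apply]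
  have h1 := congrArg R (sph_expansion (h.coordField_ne_zero hl) (R.symm (f y)))
  rw [R.apply_symm_apply, map_add, map_smul, map_sum, ← hl.2.2.self_of_nhds, ← hR,
    ← hl.2.2.self_of_nhds, ← h.support_eq.self_of_nhds] at h1
  rw [recoveryFormula, (h.solvesSystem_iff hl b).1 hb]
  conv_rhs => rw [← h1]
  congr 1
  refine Finset.sum_congr rfl fun j _ => ?_
  simp only [hR, map_smul]

theorem IsLegendreData.isRegularDatum {n : ℕ} {U : TopologicalSpace.Opens (Euc n)}
    {f : AnalyticMaps U (n + 1)} {D : Set (Euc n)} {ν : Euc n → Euc (n + 1)} {a : Euc n → ℝ}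
    (h : IsLegendreData f D ν a) {y : Euc n} (hy : y ∈ D) : IsRegularDatum f.toFun ν a y := by
  obtain ⟨ν₀, hν₀, rfl, hD⟩ := h
  have hDo : IsOpen (regSet ν₀ (regSet f.toFun U)) :=
    isOpen_regSet (isOpen_regSet U.isOpen f.analyticOnNhd) hν₀.1
  have hev : ν =ᶠ[𝓝 y] ν₀ := by
    filter_upwards [hDo.mem_nhds hy] with z hz using (hD z hz).1
  refine ⟨(f.analyticOnNhd y hy.1.1).differentiableAt, (hν₀.1 y hy.1).congr hev.symm, ?_, fun v => ?_, ?_, ?_⟩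
  · filter_upwards [hDo.mem_nhds hy] with z hz
    rw [(hD z hz).1]
    exact (hν₀.2 z hz.1).1
  · rw [(hD y hy).1]
    exact (hν₀.2 y hy.1).2 v
  · filter_upwards [hDo.mem_nhds hy] with z hz
    rw [(hD z hz).1, (hD z hz).2]
  · rw [hev.fderiv_eq]
    exact hy.2

theorem IsLegendreData.subset_closure {n : ℕ} {U : TopologicalSpace.Opens (Euc n)}
    {f : AnalyticMaps U (n + 1)} (hf : IsPseudoRegularFrontal f) {D : Set (Euc n)}
    {ν : Euc n → Euc (n + 1)} {a : Euc n → ℝ} (h : IsLegendreData f D ν a) :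
    (U : Set (Euc n)) ⊆ closure D := by
  obtain ⟨ν₀, hν₀, rfl, -⟩ := h
  obtain ⟨hdense, ν₁, hν₁, hdense₁⟩ := hf
  rw [hν₀.regSet_eq (isOpen_regSet U.isOpen f.analyticOnNhd) (fun x hx => hx.2) hν₁]
  exact hdense.trans (closure_minimal hdense₁ isClosed_closure)

end LegendreRecovery

end

theorem theorem2 (n : ℕ) (hn : 0 < n)
    (U : TopologicalSpace.Opens (LegendreRecovery.Euc n)) :
    (∀ f : LegendreRecovery.AnalyticMaps U (n + 1), LegendreRecovery.IsPseudoRegularFrontal f →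
      ∀ (D : Set (LegendreRecovery.Euc n))
        (ν : LegendreRecovery.Euc n → LegendreRecovery.Euc (n + 1))
        (a : LegendreRecovery.Euc n → ℝ), LegendreRecovery.IsLegendreData f D ν a →
        -- every point of `U` is a limit of points of `Reg(ν)`
        (∀ x ∈ U, ∃ y : ℕ → LegendreRecovery.Euc n,
          (∀ i, y i ∈ D) ∧ Tendsto y atTop (𝓝 x)) ∧
        -- at every point of `Reg(ν)` spherical coordinates of `ν` exist
        (∀ y ∈ D, ∃ R θ, LegendreRecovery.IsSphericalLift ν y R θ) ∧
        -- and any prescribed (for example the standard) ones may be used where nondegenerate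
        (∀ y ∈ D, ∀ R : LegendreRecovery.Euc (n + 1) ≃ₗᵢ[ℝ] LegendreRecovery.Euc (n + 1),
          ∀ t ∈ LegendreRecovery.angleCube n, (∀ j, LegendreRecovery.coordField t j ≠ 0) →
            ν y = R (LegendreRecovery.sph t) →
            ∃ θ, LegendreRecovery.IsSphericalLift ν y R θ ∧ θ y = t) ∧
        -- the linear system for the coefficients has a unique solution
        (∀ y ∈ D, ∀ R θ, LegendreRecovery.IsSphericalLift ν y R θ →
          (∀ j, LegendreRecovery.coordField (θ y) j ≠ 0) ∧
            ∃! b, LegendreRecovery.SolvesSystem a θ y b) ∧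
        -- and `f` is recovered as a limit along any sequence of points of `Reg(ν)`
        (∀ x ∈ U, ∀ y : ℕ → LegendreRecovery.Euc n,
          (∀ i, y i ∈ D) → Tendsto y atTop (𝓝 x) →
          ∀ (R : ℕ → LegendreRecovery.Euc (n + 1) ≃ₗᵢ[ℝ] LegendreRecovery.Euc (n + 1))
            (θ : ℕ → LegendreRecovery.Euc n → LegendreRecovery.Euc n) (b : ℕ → Fin n → ℝ),
            (∀ i, LegendreRecovery.IsSphericalLift ν (y i) (R i) (θ i)) →
            (∀ i, LegendreRecovery.SolvesSystem a (θ i) (y i) (b i)) →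
            Tendsto
              (fun i => LegendreRecovery.recoveryFormula ν a (y i) (R i) (θ i) (b i))
              atTop (𝓝 (f.toFun x)))) ∧
    Dense {f : LegendreRecovery.AnalyticMaps U (n + 1) |
      LegendreRecovery.IsPseudoRegularFrontal f} := by
  refine ⟨fun f hf D ν a hL => ⟨fun x hx => ?_, fun y hy => ?_, fun y hy R t ht htc hyt => ?_,
    fun y hy R θ hl => ?_, fun x hx y hy hyx R θ b hl hb => ?_⟩,
    LegendreRecovery.dense_isPseudoRegularFrontal U⟩
  · exact mem_closure_iff_seq_limit.1 (hL.subset_closure hf hx)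
  · exact (hL.isRegularDatum hy).exists_rotation_lift
  · exact (hL.isRegularDatum hy).exists_lift R ht htc hyt
  · have h := hL.isRegularDatum hy
    refine ⟨h.coordField_ne_zero hl, _, (h.solvesSystem_iff hl _).2 rfl, fun b hb => ?_⟩
    exact (h.solvesSystem_iff hl b).1 hb
  · simp only [fun i => (hL.isRegularDatum (hy i)).recoveryFormula_eq (hl i) (hb i)]
    exact (f.analyticOnNhd x hx).continuousAt.tendsto.comp hyx
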